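/- Let $V$ be a complex manifold of dimension $n$, let $p\ge 0$ be an integer, and let $T$ be a positive plurisubharmonic current of bidimension $(p,p)$ on $V$, that is, a positive current of bidimension $(p,p)$ such that $dd^cT$ is a positive current. For $a\in V$ choose holomorphic coordinates $z=(z_1,\dots,z_n)$ on a neighbourhood of $a$, put $\omega=\sum_{k} i\,dz_k\wedge d\bar z_k$, let $B(a,r)$ be the Euclidean ball with centre $a$ and radius $r$ in these coordinates, and let $$\nu(T,a)=\lim_{r\to 0^+}\frac{1}{2^p\pi^p r^{2p}}\langle T,1_{B(a,r)}\,\omega^p\rangle$$ be the Lelong number of $T$ at $a$; this limit exists, is finite, and its value is known not to depend on the coordinates. Then: (1) For every $\delta>0$ the level set $\{a\in V:\nu(T,a)\ge\delta\}$ is closed in $V$ and has locally finite $2p$-dimensional Hausdorff measure $\mathcal H^{2p}$. (2) If $\delta>0$ is such that $\{a\in V:\nu(T,a)\ge\delta\}$ is dense in $\operatorname{supp}(T)$, then $\nu(T,a)\ge\delta$ for every $a\in\operatorname{supp}(T)$, and $\operatorname{supp}(T)$ has locally finite $\mathcal H^{2p}$ measure. -/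

import Mathlib

open Set Filter Topology TopologicalSpace MeasureTheory
open scoped ENNReal NNReal ContDiff Manifold Distributions ComplexOrder

noncomputable section

namespace CurrentTheory

/-! ### Forms on `ℂⁿ` -/

/-- `ℂⁿ` with the Euclidean norm. -/
abbrev Cn (n : ℕ) : Type := EuclideanSpace ℂ (Fin n)

/-- Complex-valued `ℝ`-multilinear alternating `k`-forms on `ℂⁿ`. -/
abbrev Form (n k : ℕ) : Type := (Cn n) [⋀^Fin k]→L[ℝ] ℂ

/-- The determinant as a continuous `ℝ`-multilinear alternating map of its rows. -/
def detForm (k : ℕ) : (Fin k → ℂ) [⋀^Fin k]→L[ℝ] ℂ where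
  toFun M := Matrix.det (Matrix.of M)
  map_update_add' {inst} M i x y := by
    have e : inst = instDecidableEqFin k := Subsingleton.elim _ _
    subst e
    exact Matrix.det_updateRow_add (Matrix.of M) i x y
  map_update_smul' {inst} M i c x := by
    have e : inst = instDecidableEqFin k := Subsingleton.elim _ _
    subst e
    have h := Matrix.det_updateRow_smul (Matrix.of M) i (c : ℂ) x
    have hx : (c : ℂ) • x = c • x := by
      funext j
      simp
    rw [hx, ← smul_eq_mul, Complex.coe_smul] at h
    exact h
  map_eq_zero_of_eq' M i j h hij :=
    (Matrix.detRowAlternating (n := Fin k) (R := ℂ)).map_eq_zero_of_eq M h hij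
  cont := Continuous.matrix_det (continuous_id (X := Fin k → Fin k → ℂ))

/-- The exterior product `ℓ₀ ∧ ⋯ ∧ ℓ_{k-1}` of `1`-forms, that is
`(v₀, …, v_{k-1}) ↦ det (ℓ_i (v_j))`. -/
def wedge {n k : ℕ} (l : Fin k → (Cn n →L[ℝ] ℂ)) : Form n k :=
  (detForm k).compContinuousLinearMap (ContinuousLinearMap.pi l)

theorem wedge_apply {n k : ℕ} (l : Fin k → (Cn n →L[ℝ] ℂ)) (v : Fin k → Cn n) :
    wedge l v = Matrix.det (Matrix.of fun j i => l i (v j)) := rfl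

/-- The form `(i α₀ ∧ ᾱ₀) ∧ ⋯ ∧ (i α_{p-1} ∧ ᾱ_{p-1})` attached to `(1,0)`-covectors `α_j`. -/
def elemPositive {n p : ℕ} (α : Fin p → (Cn n →L[ℂ] ℂ)) : Form n (2 * p) :=
  wedge fun i : Fin (2 * p) =>
    if (i : ℕ) % 2 = 0 then
      Complex.I • (α ⟨(i : ℕ) / 2, by omega⟩).restrictScalars ℝ
    else
      (Complex.conjCLE : ℂ →L[ℝ] ℂ).comp ((α ⟨(i : ℕ) / 2, by omega⟩).restrictScalars ℝ)

/-- The cone of strongly positive `(p,p)`-forms: the convex cone generated by the forms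
`(i α₀ ∧ ᾱ₀) ∧ ⋯ ∧ (i α_{p-1} ∧ ᾱ_{p-1})`. -/
def stronglyPositive (n p : ℕ) : PointedCone ℝ (Form n (2 * p)) :=
  PointedCone.hull ℝ (Set.range (elemPositive (n := n) (p := p)))

/-- `ωᵖ` for `ω = ∑ i dz_k ∧ dz̄_k`, expanded as a sum over `κ` of
`(i dz_{κ 0} ∧ dz̄_{κ 0}) ∧ ⋯ ∧ (i dz_{κ (p-1)} ∧ dz̄_{κ (p-1)})`. -/
def omegaPow (n p : ℕ) : Form n (2 * p) :=
  ∑ κ : Fin p → Fin n, elemPositive fun j => EuclideanSpace.proj (𝕜 := ℂ) (κ j)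

/-- A `k`-form (with `k = r + s`) has bidegree `(r,s)` when multiplying all arguments by a complex
number `u` of modulus one multiplies its value by `uʳ ūˢ`. -/
def HasBidegree {n k : ℕ} (r s : ℕ) (w : Form n k) : Prop :=
  ∀ u : ℂ, ‖u‖ = 1 → ∀ v : Fin k → Cn n,
    w (fun j => u • v j) = u ^ r * (starRingEnd ℂ u) ^ s * w v

/-- Multiplication by the complex number `c` on `ℂⁿ`, as an `ℝ`-linear map. -/
def cmul (n : ℕ) (c : ℂ) : Cn n →L[ℝ] Cn n :=
  (c • ContinuousLinearMap.id ℂ (Cn n)).restrictScalars ℝ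

/-- Composition of a form with multiplication by `c`. -/
def twist {n k : ℕ} (c : ℂ) : Form n k →L[ℝ] Form n k :=
  ContinuousAlternatingMap.compContinuousLinearMapCLM (cmul n c)

/-! ### Test forms and the operator `ddᶜ` -/

/-- Smooth `k`-forms with compact support in the open set `Ω` of `ℂⁿ`. -/
abbrev TestForm {n : ℕ} (Ω : Opens (Cn n)) (k : ℕ) : Type := 𝓓(Ω, Form n k)

theorem contDiff_extDeriv {n k : ℕ} {w : Cn n → Form n k} (hw : ContDiff ℝ ∞ w) :
    ContDiff ℝ ∞ (extDeriv w) := by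
  have h : ContDiff ℝ ∞ (fderiv ℝ w) := hw.fderiv_right (m := ∞) (by simp)
  exact (ContinuousAlternatingMap.alternatizeUncurryFinCLM ℝ (Cn n) ℂ (n := k)).contDiff.comp h

theorem support_extDeriv_subset {n k : ℕ} (w : Cn n → Form n k) :
    tsupport (extDeriv w) ⊆ tsupport w := by
  refine (closure_mono ?_).trans (tsupport_fderiv_subset ℝ (f := w))
  intro x hx
  rw [Function.mem_support] at hx ⊢
  intro h
  apply hx
  unfold extDeriv
  rw [h]
  exact (ContinuousAlternatingMap.alternatizeUncurryFinCLM ℝ (Cn n) ℂ (n := k)).map_zero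

/-- The exterior derivative of a test form. -/
def TestForm.d {n : ℕ} {Ω : Opens (Cn n)} {k : ℕ} (w : TestForm Ω k) : TestForm Ω (k + 1) where
  toFun := extDeriv w
  contDiff' := contDiff_extDeriv w.contDiff
  hasCompactSupport' := w.hasCompactSupport.mono'
    (subset_closure.trans (support_extDeriv_subset _))
  tsupport_subset' := (support_extDeriv_subset _).trans w.tsupport_subset

/-- A test form with all values composed with multiplication by `c`. -/
def TestForm.twist {n : ℕ} {Ω : Opens (Cn n)} {k : ℕ} (c : ℂ) (w : TestForm Ω k) :
    TestForm Ω k where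
  toFun x := CurrentTheory.twist c (w x)
  contDiff' := (CurrentTheory.twist c).contDiff.comp w.contDiff
  hasCompactSupport' := w.hasCompactSupport.comp_left (map_zero _)
  tsupport_subset' := (tsupport_comp_subset (map_zero (CurrentTheory.twist c)) w).trans
    w.tsupport_subset

/-- `dᶜ = i (∂̄ - ∂)`, written as `J⁻¹ d J` with `(J w)(v₀, …) = w(i v₀, …)`. -/
def TestForm.dc {n : ℕ} {Ω : Opens (Cn n)} {k : ℕ} (w : TestForm Ω k) : TestForm Ω (k + 1) :=
  ((w.twist Complex.I).d).twist (-Complex.I)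

/-- `ddᶜ = 2 i ∂∂̄`. -/
def TestForm.ddc {n : ℕ} {Ω : Opens (Cn n)} {k : ℕ} (w : TestForm Ω k) : TestForm Ω (k + 2) :=
  w.dc.d

/-- The test form `f w₀`, for a test function `f` and a constant form `w₀`. -/
def TestForm.smulConst {n : ℕ} {Ω : Opens (Cn n)} {k : ℕ} (f : 𝓓(Ω, ℝ)) (w₀ : Form n k) :
    TestForm Ω k where
  toFun x := f x • w₀
  contDiff' := f.contDiff.smul contDiff_const
  hasCompactSupport' := f.hasCompactSupport.smul_right
  tsupport_subset' := (tsupport_smul_subset_left _ _).trans f.tsupport_subset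

/-! ### Currents on open subsets of `ℂⁿ` -/

/-- Currents of dimension `k` on the open set `Ω` of `ℂⁿ`: continuous linear forms on the
smooth compactly supported `k`-forms. -/
abbrev LocalCurrent {n : ℕ} (Ω : Opens (Cn n)) (k : ℕ) : Type := TestForm Ω k →L[ℂ] ℂ

namespace LocalCurrent

variable {n : ℕ} {Ω : Opens (Cn n)}

/-- Bidimension `(p,p)`: the current vanishes on all test forms of a bidegree
`(r,s) ≠ (p,p)`, `r + s = 2p`. -/
def IsBidim {p : ℕ} (T : LocalCurrent Ω (2 * p)) : Prop :=
  ∀ r s : ℕ, r + s = 2 * p → (r, s) ≠ (p, p) →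
    ∀ w : TestForm Ω (2 * p), (∀ x, HasBidegree r s (w x)) → T w = 0

/-- Positivity: the current is nonnegative on test forms with strongly positive values. -/
def IsPositive {p : ℕ} (T : LocalCurrent Ω (2 * p)) : Prop :=
  ∀ w : TestForm Ω (2 * p), (∀ x, w x ∈ stronglyPositive n p) → 0 ≤ T w

/-- `ddᶜ T` is a positive current, where `⟨ddᶜ T, w⟩ = ⟨T, ddᶜ w⟩`. For `p = 0` this is void,
`ddᶜ T` being of negative dimension. -/
def IsPlurisubharmonic : {p : ℕ} → LocalCurrent Ω (2 * p) → Prop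
  | 0, _ => True
  | q + 1, T => ∀ w : TestForm Ω (2 * q), (∀ x, w x ∈ stronglyPositive n q) → 0 ≤ T w.ddc

/-- The mass `⟨T, 1_U ωᵖ⟩` that the trace measure `T ∧ ωᵖ` of a positive current gives to the
open set `U`: the supremum of `⟨T, f ωᵖ⟩` over the test functions `0 ≤ f ≤ 1` with
compact support in `U`. -/
def traceMass {p : ℕ} (T : LocalCurrent Ω (2 * p)) (U : Set (Cn n)) : ℝ≥0∞ :=
  ⨆ (f : 𝓓(Ω, ℝ)) (_ : ∀ x, 0 ≤ f x ∧ f x ≤ 1) (_ : tsupport f ⊆ U),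
    ENNReal.ofReal (T (TestForm.smulConst f (omegaPow n p))).re

/-- `⟨T, 1_{B(a,r)} ωᵖ⟩ / (2ᵖ πᵖ r^{2p})`. -/
def massRatio {p : ℕ} (T : LocalCurrent Ω (2 * p)) (a : Cn n) (r : ℝ) : ℝ≥0∞ :=
  T.traceMass (Metric.ball a r) / ENNReal.ofReal (2 ^ p * Real.pi ^ p * r ^ (2 * p))

/-- The Lelong number at `a` of a positive plurisubharmonic current on an open subset of `ℂⁿ`:
the limit of the mass ratios as `r → 0⁺`. -/
def lelong {p : ℕ} (T : LocalCurrent Ω (2 * p)) (a : Cn n) : ℝ≥0∞ :=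
  limUnder (𝓝[>] (0 : ℝ)) (T.massRatio a)

end LocalCurrent

/-! ### Currents on complex manifolds -/

section Manifold

variable (n : ℕ) (V : Type*) [TopologicalSpace V] [ChartedSpace (Cn n) V]

/-- The holomorphic charts of `V`. -/
abbrev HolChart : Type _ :=
  {φ : OpenPartialHomeomorph V (Cn n) // φ ∈ IsManifold.maximalAtlas 𝓘(ℂ, Cn n) ω V}

variable {n V}

/-- The image of a chart. -/
def HolChart.image (φ : HolChart n V) : Opens (Cn n) := ⟨φ.1.target, φ.1.open_target⟩

variable (n V)

/-- A current of dimension `k` on the complex manifold `V`: a current on the image of each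
holomorphic chart, such that the currents of two charts correspond to each other under the
coordinate change (on forms with compact support in the domain of the coordinate change). -/
structure Current (k : ℕ) where
  /-- the expression of the current in a chart -/
  inChart : (φ : HolChart n V) → LocalCurrent φ.image k
  /-- compatibility with coordinate changes -/
  compat : ∀ (φ ψ : HolChart n V) (α : TestForm φ.image k) (β : TestForm ψ.image k),
    tsupport α ⊆ (φ.1.symm.trans ψ.1).source →
    tsupport β ⊆ (ψ.1.symm.trans φ.1).source →
    (∀ y ∈ (ψ.1.symm.trans φ.1).source,
      β y = (α (φ.1 (ψ.1.symm y))).compContinuousLinearMap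
        (fderiv ℝ (fun z => φ.1 (ψ.1.symm z)) y)) →
    inChart φ α = inChart ψ β

variable {n V}

/-- `S ⊆ V` has locally finite `d`-dimensional Hausdorff measure: in every holomorphic chart,
every point has a neighbourhood in which the image of `S` has finite measure. -/
def LocallyFiniteHausdorff (n : ℕ) {V : Type*} [TopologicalSpace V] [ChartedSpace (Cn n) V]
    (d : ℝ) (S : Set V) : Prop :=
  ∀ φ : HolChart n V, ∀ y ∈ φ.1.target, ∃ U ∈ 𝓝 y, μH[d] (U ∩ φ.1 '' (S ∩ φ.1.source)) < ⊤

namespace Current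

variable {p k : ℕ}

/-- Bidimension `(p,p)`. -/
def IsBidim (T : Current n V (2 * p)) : Prop := ∀ φ, (T.inChart φ).IsBidim

/-- Positive currents. -/
def IsPositive (T : Current n V (2 * p)) : Prop := ∀ φ, (T.inChart φ).IsPositive

/-- Plurisubharmonic currents: `ddᶜ T` is positive. -/
def IsPlurisubharmonic (T : Current n V (2 * p)) : Prop :=
  ∀ φ, (T.inChart φ).IsPlurisubharmonic

/-- `T` vanishes on the open set `U`: it vanishes on every test form with support in `U`
lying in a chart. -/
def VanishesOn (T : Current n V k) (U : Set V) : Prop :=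
  ∀ (φ : HolChart n V) (w : TestForm φ.image k),
    tsupport w ⊆ φ.1 '' (U ∩ φ.1.source) → T.inChart φ w = 0

/-- The support of `T`: the complement of the largest open set on which `T` vanishes. -/
def support (T : Current n V k) : Set V :=
  {a | ∀ U : Set V, IsOpen U → a ∈ U → ¬ T.VanishesOn U}

/-- The Lelong number of `T` at `a`, computed in holomorphic coordinates around `a`. For a positive
plurisubharmonic current the value is the same in all coordinate systems; in order not to
choose one, the infimum over all of them is taken. -/
def lelong (T : Current n V (2 * p)) (a : V) : ℝ≥0∞ :=
  ⨅ (φ : HolChart n V) (_ : a ∈ φ.1.source), (T.inChart φ).lelong (φ.1 a)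

/-- The level set `{a | ν(T,a) ≥ δ}`. -/
def levelSet (T : Current n V (2 * p)) (δ : ℝ) : Set V := {a | ENNReal.ofReal δ ≤ T.lelong a}

end Current

end Manifold

end CurrentTheory

end

open CurrentTheory

/-! Everything rests on the monotonicity of the mass ratio `massRatio T a r` in `r`, as long as the
ball stays in the chart. Put s = |x - a|², β = i∂s ∧ ∂̄s, and let the bidimension be p = q + 1. For
a radial function, ddᶜ(H(s) ω^q) = 2H'(s) ω^p + 2H''(s) β ∧ ω^q, and a Cauchy-Schwarz inequality for
forms makes s ω^p - p β ∧ ω^q strongly positive.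

Given a decreasing cutoff χ and scales t₁ ≤ t₂, one solves for H so that t₂^{-p} χ(s/t₂) ω^p -
t₁^{-p} χ(s/t₁) ω^p - ½ ddᶜ(H ω^q) = (H''/p)(s ω^p - p β ∧ ω^q). The solution has H ≥ 0, H'' ≥ 0 and
vanishes for large s, so positivity of `T` and of ddᶜ`T` together give monotonicity for smooth
cutoffs (`traceIntegral_cutoff_mono`). Domination by cutoffs carries it over to balls
(`traceMass_ball_le`).

Monotonicity yields the limit, its upper semicontinuity in a (`eventually_lelong_lt`), hence closed
level sets, and the lower bound δ 2^p π^p ε^{2p} for the mass of an ε-ball centred on the level set.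
Disjoint such balls share a finite total mass, so O(ε^{-2p}) balls of radius 2ε cover the level set
locally (`exists_finset_cover`), which bounds its Hausdorff measure. The statement on the support
follows from closedness. -/

noncomputable section

namespace CurrentTheory

/-! ### Linear structure on forms -/

section

instance instAddCommGroupForm (n k : ℕ) : AddCommGroup (Form n k) :=
  ContinuousAlternatingMap.instAddCommGroup

instance instModuleComplexForm (n k : ℕ) : Module ℂ (Form n k) :=
  ContinuousAlternatingMap.instModule

instance instModuleRealForm (n k : ℕ) : Module ℝ (Form n k) :=
  ContinuousAlternatingMap.instModule

/-! ### Exterior multiplication by a covector -/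

/-- Exterior multiplication `w ↦ ℓ ∧ w` by a covector, as a bilinear map. -/
def extMul (n k : ℕ) : (Cn n →L[ℝ] ℂ) →ₗ[ℂ] Form n k →ₗ[ℂ] Form n (k + 1) :=
  LinearMap.mk₂ ℂ
    (fun l w => ContinuousAlternatingMap.alternatizeUncurryFin (l.smulRight w))
    (fun l m w => by
      rw [← ContinuousAlternatingMap.alternatizeUncurryFin_add]
      congr 1; ext v; simp [add_mul])
    (fun c l w => by
      rw [← ContinuousAlternatingMap.alternatizeUncurryFin_smul]
      congr 1; ext v; simp [mul_assoc])
    (fun l w w' => by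
      rw [← ContinuousAlternatingMap.alternatizeUncurryFin_add]
      congr 1; ext v; simp)
    (fun c l w => by
      rw [← ContinuousAlternatingMap.alternatizeUncurryFin_smul]
      congr 1; ext v; simp [mul_left_comm])

variable {n k : ℕ}

theorem extMul_def (l : Cn n →L[ℝ] ℂ) (w : Form n k) :
    extMul n k l w = ContinuousAlternatingMap.alternatizeUncurryFin (l.smulRight w) := rfl

theorem extMul_apply (l : Cn n →L[ℝ] ℂ) (w : Form n k) (v : Fin (k + 1) → Cn n) :
    extMul n k l w v = ∑ i : Fin (k + 1), (-1) ^ (i : ℕ) * (l (v i) * w (i.removeNth v)) := by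
  rw [extMul_def, ContinuousAlternatingMap.alternatizeUncurryFin_apply]
  refine Finset.sum_congr rfl fun i _ => ?_
  simp [zsmul_eq_mul]

theorem extMul_anticomm (l m : Cn n →L[ℝ] ℂ) (w : Form n k) :
    extMul n (k + 1) l (extMul n k m w) = -extMul n (k + 1) m (extMul n k l w) := by
  rw [eq_neg_iff_add_eq_zero]
  have : ContinuousSMul ℂ (Cn n →L[ℝ] Form n k) :=
    (inferInstance : NormedSpace ℂ (Cn n →L[ℝ] Form n k)).toIsBoundedSMul.continuousSMul
  -- The bilinear map (x, y) ↦ (l(x)m(y) + m(x)l(y)) w is symmetric, so alternating twice kills it.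
  have key := ContinuousAlternatingMap.alternatizeUncurryFin_alternatizeUncurryFinCLM_comp_of_symmetric
    (f := l.smulRight (m.smulRight w) + m.smulRight (l.smulRight w)) (fun x y => by
      ext v; simp; ring)
  rw [ContinuousLinearMap.comp_add, ContinuousAlternatingMap.alternatizeUncurryFin_add] at key
  rw [← key]
  congr 1
  all_goals
    rw [extMul_def]
    congr 1
    ext x : 1
    simp [extMul_def]

theorem extMul_self (l : Cn n →L[ℝ] ℂ) (w : Form n k) :
    extMul n (k + 1) l (extMul n k l w) = 0 := by
  ext v
  have h := congrArg (fun f : Form n (k + 2) => f v) (extMul_anticomm l l w)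
  exact self_eq_neg.mp h

/-- Laplace expansion of the determinant along its first column. -/
theorem wedge_cons (l : Cn n →L[ℝ] ℂ) (m : Fin k → (Cn n →L[ℝ] ℂ)) :
    wedge (Fin.cons l m) = extMul n k l (wedge m) := by
  ext v
  rw [extMul_apply, wedge_apply, Matrix.det_succ_column_zero]
  refine Finset.sum_congr rfl fun i _ => ?_
  rw [wedge_apply, mul_assoc]
  rfl

/-- The conjugate of a `(1,0)`-covector. -/
def conjCovector (α : Cn n →L[ℂ] ℂ) : Cn n →L[ℝ] ℂ :=
  (Complex.conjCLE : ℂ →L[ℝ] ℂ).comp (α.restrictScalars ℝ)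

@[simp]
theorem conjCovector_apply (α : Cn n →L[ℂ] ℂ) (v : Cn n) :
    conjCovector α v = starRingEnd ℂ (α v) := rfl

/-- Exterior multiplication by the real `(1,1)`-form `i α ∧ ᾱ`. -/
def mulElem (k : ℕ) (α : Cn n →L[ℂ] ℂ) : Form n k →ₗ[ℂ] Form n (k + 2) :=
  (extMul n (k + 1) (Complex.I • α.restrictScalars ℝ)).comp (extMul n k (conjCovector α))

theorem mulElem_apply (α : Cn n →L[ℂ] ℂ) (w : Form n k) :
    mulElem k α w =
      Complex.I • extMul n (k + 1) (α.restrictScalars ℝ) (extMul n k (conjCovector α) w) := by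
  simp [mulElem]

theorem mulElem_comm (α β : Cn n →L[ℂ] ℂ) (w : Form n k) :
    mulElem (k + 2) α (mulElem k β w) = mulElem (k + 2) β (mulElem k α w) := by
  simp only [mulElem_apply, map_smul]
  rw [extMul_anticomm (conjCovector α) (β.restrictScalars ℝ), map_neg,
    extMul_anticomm (α.restrictScalars ℝ) (β.restrictScalars ℝ), neg_neg,
    extMul_anticomm (conjCovector α) (conjCovector β), map_neg,
    extMul_anticomm (α.restrictScalars ℝ) (conjCovector β)]
  simp only [neg_neg]

theorem mulElem_self (α : Cn n →L[ℂ] ℂ) (w : Form n k) :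
    mulElem (k + 2) α (mulElem k α w) = 0 := by
  simp only [mulElem_apply, map_smul]
  rw [extMul_anticomm (conjCovector α) (α.restrictScalars ℝ), extMul_self]
  simp

/-- The new factor occupies the slots 0 and 1, so for the others the parity of the slot is unchanged
and its half shifts by one. -/
theorem elemPositive_cons {q : ℕ} (α : Cn n →L[ℂ] ℂ) (β : Fin q → (Cn n →L[ℂ] ℂ)) :
    elemPositive (p := q + 1) (Fin.cons α β) = mulElem (2 * q) α (elemPositive β) := by
  unfold elemPositive mulElem
  rw [LinearMap.comp_apply, ← wedge_cons, ← wedge_cons]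
  congr 1
  funext i
  obtain ⟨i, hi⟩ := i
  match i, hi with
  | 0, _ =>
    have h : (⟨0 / 2, by omega⟩ : Fin (q + 1)) = 0 := by ext; simp
    simp only [h, Fin.cons_zero]
    rfl
  | 1, _ =>
    have h : (⟨1 / 2, by omega⟩ : Fin (q + 1)) = 0 := by ext; simp
    simp only [h, Fin.cons_zero]
    rfl
  | i + 2, hi =>
    have h1 : (i + 2) % 2 = i % 2 := by omega
    have h2 : (⟨(i + 2) / 2, by omega⟩ : Fin (q + 1)) = Fin.succ ⟨i / 2, by omega⟩ := by
      ext; simp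
    have h3 : (⟨i + 2, hi⟩ : Fin (2 * q + 1 + 1)) = Fin.succ (Fin.succ ⟨i, by omega⟩) := rfl
    simp only [h1, h2, Fin.cons_succ]
    erw [h3]
    simp only [Fin.cons_succ]

/-! ### The strongly positive cone and Cauchy-Schwarz for forms -/

theorem mulElem_mem_stronglyPositive {q : ℕ} (α : Cn n →L[ℂ] ℂ) {w : Form n (2 * q)}
    (hw : w ∈ stronglyPositive n q) :
    mulElem (2 * q) α w ∈ stronglyPositive n (q + 1) := by
  refine Submodule.span_induction ?_ ?_ ?_ ?_ hw
  · rintro _ ⟨β, rfl⟩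
    rw [← elemPositive_cons]
    exact PointedCone.subset_hull ⟨_, rfl⟩
  · rw [map_zero]; exact Submodule.zero_mem _
  · intro x y _ _ hx hy
    rw [map_add]; exact Submodule.add_mem _ hx hy
  · rintro ⟨c, hc⟩ x _ hx
    have : mulElem (2 * q) α ((⟨c, hc⟩ : {c : ℝ // 0 ≤ c}) • x)
        = (⟨c, hc⟩ : {c : ℝ // 0 ≤ c}) • mulElem (2 * q) α x := by
      change mulElem (2 * q) α (c • x) = c • mulElem (2 * q) α x
      exact LinearMap.map_smul_of_tower _ c x
    rw [this]; exact Submodule.smul_mem _ _ hx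

theorem smul_mem_stronglyPositive {q : ℕ} {c : ℝ} (hc : 0 ≤ c) {w : Form n (2 * q)}
    (hw : w ∈ stronglyPositive n q) : c • w ∈ stronglyPositive n q :=
  Submodule.smul_mem (stronglyPositive n q) (⟨c, hc⟩ : {c : ℝ // 0 ≤ c}) hw

/-- The coordinate covectors. -/
abbrev coord (j : Fin n) : Cn n →L[ℂ] ℂ := EuclideanSpace.proj (𝕜 := ℂ) j

theorem omegaPow_succ (n q : ℕ) :
    omegaPow n (q + 1) = ∑ j : Fin n, mulElem (2 * q) (coord j) (omegaPow n q) := by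
  unfold omegaPow
  rw [← (Fin.consEquiv fun _ : Fin (q + 1) => Fin n).sum_comp, Fintype.sum_prod_type]
  refine Finset.sum_congr rfl fun j _ => ?_
  rw [map_sum]
  refine Finset.sum_congr rfl fun κ _ => ?_
  rw [← elemPositive_cons]
  congr 1
  funext i
  refine Fin.cases rfl (fun i => rfl) i

theorem omegaPow_mem_stronglyPositive (n q : ℕ) : omegaPow n q ∈ stronglyPositive n q :=
  Submodule.sum_mem _ fun _ _ => PointedCone.subset_hull ⟨_, rfl⟩

/-- The `(1,0)`-covector `v ↦ ⟨x, v⟩`. -/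
abbrev radial (x : Cn n) : Cn n →L[ℂ] ℂ := innerSL ℂ x

theorem conjCovector_smul (c : ℂ) (α : Cn n →L[ℂ] ℂ) :
    conjCovector (c • α) = starRingEnd ℂ c • conjCovector α := by
  ext v; simp

theorem conjCovector_sub (α β : Cn n →L[ℂ] ℂ) :
    conjCovector (α - β) = conjCovector α - conjCovector β := by
  ext v; simp

theorem radial_restrictScalars (x : Cn n) :
    (radial x).restrictScalars ℝ
      = ∑ j, starRingEnd ℂ (x j) • (coord j : Cn n →L[ℂ] ℂ).restrictScalars ℝ := by
  ext v
  simp [PiLp.inner_apply, mul_comm]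

theorem conjCovector_radial (x : Cn n) :
    conjCovector (radial x) = ∑ j, x j • conjCovector (coord j : Cn n →L[ℂ] ℂ) := by
  ext v
  simp [PiLp.inner_apply, mul_comm]

/-- Lagrange's identity behind Cauchy-Schwarz, with the vector (dz_j) in place of a second numerical
vector. The factor 2 appears because each pair {i, j} is counted twice. -/
theorem sum_mulElem_lagrange (x : Cn n) (w : Form n k) :
    ∑ i : Fin n, ∑ j : Fin n, mulElem k (x i • coord j - x j • coord i) w
      = (2 : ℝ) • (‖x‖ ^ 2 • ∑ j : Fin n, mulElem k (coord j) w - mulElem k (radial x) w) := by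
  set a : Fin n → Fin n → Form n (k + 2) := fun i j =>
    extMul n (k + 1) ((coord i : Cn n →L[ℂ] ℂ).restrictScalars ℝ)
      (extMul n k (conjCovector (coord j)) w) with ha
  have h1 : ∀ i j, mulElem k (x i • coord j - x j • coord i) w
      = (Complex.I * (x i * starRingEnd ℂ (x i))) • a j j
        - (Complex.I * (x i * starRingEnd ℂ (x j))) • a j i
        - (Complex.I * (x j * starRingEnd ℂ (x i))) • a i j
        + (Complex.I * (x j * starRingEnd ℂ (x j))) • a i i := by
    intro i j
    have e : (x i • coord j - x j • coord i : Cn n →L[ℂ] ℂ).restrictScalars ℝ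
        = x i • (coord j : Cn n →L[ℂ] ℂ).restrictScalars ℝ
          - x j • (coord i : Cn n →L[ℂ] ℂ).restrictScalars ℝ := rfl
    rw [mulElem_apply, e, conjCovector_sub, conjCovector_smul, conjCovector_smul]
    simp only [map_sub, map_smul, LinearMap.sub_apply, LinearMap.smul_apply, ha]
    module
  have h2 : mulElem k (radial x) w
      = ∑ i, ∑ j, (Complex.I * (x j * starRingEnd ℂ (x i))) • a i j := by
    rw [mulElem_apply, radial_restrictScalars, conjCovector_radial]
    simp only [map_sum, map_smul, LinearMap.sum_apply, LinearMap.smul_apply, Finset.smul_sum,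
      smul_smul, ha]
    rw [Finset.sum_comm]
  have h3 : ‖x‖ ^ 2 • ∑ j : Fin n, mulElem k (coord j) w
      = ∑ i, ∑ j, (Complex.I * (x i * starRingEnd ℂ (x i))) • a j j := by
    rw [EuclideanSpace.norm_sq_eq, Finset.sum_smul]
    refine Finset.sum_congr rfl fun i _ => ?_
    rw [Finset.smul_sum]
    refine Finset.sum_congr rfl fun j _ => ?_
    rw [mulElem_apply, ← Complex.coe_smul, smul_smul, Complex.mul_conj, Complex.normSq_eq_norm_sq,
      mul_comm]
  have h4 : ∑ i, ∑ j, (Complex.I * (x j * starRingEnd ℂ (x j))) • a i i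
      = ∑ i, ∑ j, (Complex.I * (x i * starRingEnd ℂ (x i))) • a j j := Finset.sum_comm
  have h5 : ∑ i, ∑ j, (Complex.I * (x i * starRingEnd ℂ (x j))) • a j i
      = ∑ i, ∑ j, (Complex.I * (x j * starRingEnd ℂ (x i))) • a i j := Finset.sum_comm
  simp only [h1, Finset.sum_add_distrib, Finset.sum_sub_distrib]
  rw [h4, h5, ← h2, ← h3]
  module

theorem norm_sq_smul_sub_mulElem_radial_mem (x : Cn n) {q : ℕ} {w : Form n (2 * q)}
    (hw : w ∈ stronglyPositive n q) :
    ‖x‖ ^ 2 • ∑ j : Fin n, mulElem (2 * q) (coord j) w - mulElem (2 * q) (radial x) w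
      ∈ stronglyPositive n (q + 1) := by
  have h := smul_mem_stronglyPositive (c := 1 / 2) (by norm_num)
    (Submodule.sum_mem (stronglyPositive n (q + 1)) (t := Finset.univ)
      fun i _ => Submodule.sum_mem _ (t := Finset.univ)
        fun j _ => mulElem_mem_stronglyPositive (x i • coord j - x j • coord i) hw)
  rw [sum_mulElem_lagrange, smul_smul] at h
  norm_num at h
  exact h

/-- `|x|² ω^p - p (i ⟨x,dz⟩ ∧ conj) ∧ ω^{p-1}` is strongly positive. -/
theorem sub_mulElem_radial_mem_stronglyPositive (x : Cn n) (q : ℕ) :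
    ‖x‖ ^ 2 • omegaPow n (q + 1) - ((q : ℝ) + 1) • mulElem (2 * q) (radial x) (omegaPow n q)
      ∈ stronglyPositive n (q + 1) := by
  induction q with
  | zero =>
    have h := norm_sq_smul_sub_mulElem_radial_mem x (omegaPow_mem_stronglyPositive n 0)
    rw [← omegaPow_succ] at h
    simpa using h
  | succ q ih =>
    rcases eq_or_ne x 0 with rfl | hx
    · have : mulElem (n := n) (2 * (q + 1)) (radial 0) = 0 := by
        ext1 w
        rw [mulElem_apply, radial_restrictScalars]
        simp
      rw [this]
      simp
    · have hs : 0 < ‖x‖ ^ 2 := by positivity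
      -- The inductive form is multiplied by |x|² ω - β, where β is the radial (1,1)-form. Since β ∧
      -- β = 0, the product is |x|² times the desired form, and |x|² is divided out.
      have h := smul_mem_stronglyPositive (inv_nonneg.2 hs.le)
        (norm_sq_smul_sub_mulElem_radial_mem x ih)
      convert h using 1
      have e1 : ∀ α : Cn n →L[ℂ] ℂ, mulElem (2 * (q + 1)) α (‖x‖ ^ 2 • omegaPow n (q + 1)
            - ((q : ℝ) + 1) • mulElem (2 * q) (radial x) (omegaPow n q))
          = ‖x‖ ^ 2 • mulElem (2 * (q + 1)) α (omegaPow n (q + 1))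
            - ((q : ℝ) + 1) • mulElem (2 * (q + 1)) α
              (mulElem (2 * q) (radial x) (omegaPow n q)) := fun α => by
        rw [map_sub, LinearMap.map_smul_of_tower, LinearMap.map_smul_of_tower]
      have e2 : ∑ j : Fin n, mulElem (2 * (q + 1)) (coord j)
            (mulElem (2 * q) (radial x) (omegaPow n q))
          = mulElem (2 * (q + 1)) (radial x) (omegaPow n (q + 1)) := by
        rw [omegaPow_succ n q, map_sum]
        exact Finset.sum_congr rfl fun j _ => mulElem_comm _ _ _
      have e3 : mulElem (2 * (q + 1)) (radial x) (mulElem (2 * q) (radial x) (omegaPow n q)) = 0 :=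
        mulElem_self _ _
      simp only [e1, Finset.sum_sub_distrib, ← Finset.smul_sum]
      rw [e2, e3, ← omegaPow_succ, smul_zero, sub_zero, ← smul_sub, smul_smul,
        inv_mul_cancel₀ hs.ne', one_smul]
      push_cast
      module

end

/-! ### The operator `ddᶜ` on radial multiples of `ω^q` -/

section

variable {n k : ℕ}

theorem twist_extMul (c : ℂ) (l : Cn n →L[ℝ] ℂ) (w : Form n k) :
    twist c (extMul n k l w) = extMul n k (l.comp (cmul n c)) (twist c w) := by
  ext v
  change extMul n k l w (fun j => cmul n c (v j)) = _
  rw [extMul_apply, extMul_apply]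
  rfl

theorem twist_mulElem (c : ℂ) (α : Cn n →L[ℂ] ℂ) (w : Form n k) :
    twist c (mulElem k α w) = ((‖c‖ : ℂ) ^ 2) • mulElem k α (twist c w) := by
  have h1 : (Complex.I • α.restrictScalars ℝ).comp (cmul n c)
      = c • (Complex.I • α.restrictScalars ℝ) := by
    ext v; simp [cmul]; ring
  have h2 : (conjCovector α).comp (cmul n c) = starRingEnd ℂ c • conjCovector α := by
    ext v; simp [cmul]
  change twist c (extMul n (k + 1) _ (extMul n k _ w)) = _
  rw [twist_extMul, twist_extMul, h1, h2, ← Complex.mul_conj']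
  simp only [map_smul, LinearMap.smul_apply, smul_smul, mulElem, LinearMap.comp_apply]
  congr 1; ring

theorem twist_omegaPow {c : ℂ} (hc : ‖c‖ = 1) (q : ℕ) :
    twist c (omegaPow n q) = omegaPow n q := by
  induction q with
  | zero =>
    ext v
    change omegaPow n 0 (fun j => cmul n c (v j)) = _
    congr 1
    funext j
    exact j.elim0
  | succ q ih =>
    rw [omegaPow_succ, map_sum]
    refine Finset.sum_congr rfl fun j _ => ?_
    refine (twist_mulElem c (coord j) (omegaPow n q)).trans ?_
    rw [ih, hc]
    simp

/-- The `ℝ`-linear map `y ↦ Im ⟨y, ·⟩ ∧ w`. -/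
def imMul (w : Form n k) : Cn n →L[ℝ] Form n (k + 1) :=
  ∑ j : Fin n,
    (((coord j : Cn n →L[ℂ] ℂ).restrictScalars ℝ).smulRight
        ((Complex.I / 2) • extMul n k (conjCovector (coord j)) w)
      - (conjCovector (coord j)).smulRight
        ((Complex.I / 2) • extMul n k ((coord j : Cn n →L[ℂ] ℂ).restrictScalars ℝ) w))

theorem imMul_apply (w : Form n k) (y : Cn n) :
    imMul w y = (Complex.I / 2) • extMul n k (conjCovector (radial y)) w
      - (Complex.I / 2) • extMul n k ((radial y).restrictScalars ℝ) w := by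
  rw [radial_restrictScalars, conjCovector_radial, imMul]
  simp [Finset.smul_sum, smul_smul, mul_comm]

/-- The derivative of a linear map is the map itself, so this computes d(Im⟨x, dx⟩ ∧ w) = ω ∧ w for
constant w. -/
theorem alternatize_imMul (w : Form n k) :
    ContinuousAlternatingMap.alternatizeUncurryFin (imMul w)
      = ∑ j : Fin n, mulElem k (coord j) w := by
  rw [← ContinuousAlternatingMap.alternatizeUncurryFinCLM_apply, imMul, map_sum]
  refine Finset.sum_congr rfl fun j _ => ?_
  rw [map_sub, ContinuousAlternatingMap.alternatizeUncurryFinCLM_apply,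
    ContinuousAlternatingMap.alternatizeUncurryFinCLM_apply, ← extMul_def, ← extMul_def,
    map_smul, map_smul, extMul_anticomm (conjCovector (coord j)), mulElem_apply]
  module

/-- Expansion of ½(α + ᾱ) ∧ (i/2)(ᾱ - α) = ½ i α ∧ ᾱ. It handles the term where d falls on the
radial coefficient. -/
theorem extMul_re_imMul (w : Form n k) (y : Cn n) :
    extMul n (k + 1) (Complex.ofRealCLM.comp (Complex.reCLM.comp ((radial y).restrictScalars ℝ)))
      (imMul w y) = (1 / 2 : ℝ) • mulElem k (radial y) w := by
  have h : Complex.ofRealCLM.comp (Complex.reCLM.comp ((radial y).restrictScalars ℝ))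
      = (1 / 2 : ℂ) • ((radial y).restrictScalars ℝ + conjCovector (radial y)) := by
    ext v
    simp [Complex.re_eq_add_conj]; ring
  rw [h, imMul_apply, mulElem_apply, ← Complex.coe_smul]
  simp only [map_sub, map_add, map_smul, LinearMap.add_apply, LinearMap.smul_apply, extMul_self]
  rw [extMul_anticomm (conjCovector (radial y))]
  push_cast
  module

theorem hasFDerivAt_norm_sub_sq (a x : Cn n) :
    HasFDerivAt (fun x : Cn n => ‖x - a‖ ^ 2)
      ((2 : ℝ) • Complex.reCLM.comp ((radial (x - a)).restrictScalars ℝ)) x := by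
  have h := (hasStrictFDerivAt_norm_sq (x - a)).hasFDerivAt.comp x ((hasFDerivAt_id x).sub_const a)
  refine h.congr_fderiv ?_
  ext v
  simp [two_mul, PiLp.inner_apply, Complex.inner]

variable {Ω : Opens (Cn n)}

/-- Multiplying the arguments by ±i leaves ω^q unchanged, so it only turns the factor Re⟨x - a, dx⟩
of df into Im⟨x - a, dx⟩. -/
theorem TestForm.dc_smulConst_omegaPow {q : ℕ} {a : Cn n} {F F₁ : ℝ → ℝ}
    (h₁ : ∀ s, HasDerivAt F (F₁ s) s) (f : 𝓓(Ω, ℝ)) (hf : ∀ x, f x = F (‖x - a‖ ^ 2)) (x : Cn n) :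
    (TestForm.smulConst f (omegaPow n q)).dc x
      = (2 * F₁ (‖x - a‖ ^ 2)) • imMul (omegaPow n q) (x - a) := by
  have e : (fun x => CurrentTheory.twist Complex.I (f x • omegaPow n q))
      = fun x => f x • omegaPow n q := by
    funext x
    rw [map_smul, twist_omegaPow (by simp)]
  have hd : HasFDerivAt (fun x => f x • omegaPow n q)
      ((F₁ (‖x - a‖ ^ 2) • ((2 : ℝ) • Complex.reCLM.comp
        ((radial (x - a)).restrictScalars ℝ))).smulRight (omegaPow n q)) x := by
    have h := (h₁ (‖x - a‖ ^ 2)).comp_hasFDerivAt x (hasFDerivAt_norm_sub_sq a x)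
    have h' : HasFDerivAt f _ x := h.congr_of_eventuallyEq (Eventually.of_forall hf)
    exact h'.smul_const (omegaPow n q)
  change CurrentTheory.twist (-Complex.I)
    (extDeriv (fun x => CurrentTheory.twist Complex.I (f x • omegaPow n q)) x) = _
  rw [e, extDeriv, hd.fderiv]
  have e2 : ((F₁ (‖x - a‖ ^ 2) • ((2 : ℝ) • Complex.reCLM.comp
        ((radial (x - a)).restrictScalars ℝ))).smulRight (omegaPow n q))
      = (((2 * F₁ (‖x - a‖ ^ 2) : ℝ) : ℂ) • Complex.ofRealCLM.comp (Complex.reCLM.comp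
        ((radial (x - a)).restrictScalars ℝ))).smulRight (omegaPow n q) := by
    ext v u
    simp only [ContinuousLinearMap.smulRight_apply, smul_apply,
      ContinuousLinearMap.comp_apply, ContinuousAlternatingMap.smul_apply, smul_eq_mul,
      Complex.real_smul, Complex.ofRealCLM_apply]
    push_cast
    ring
  have e3 : (((2 * F₁ (‖x - a‖ ^ 2) : ℝ) : ℂ) • Complex.ofRealCLM.comp (Complex.reCLM.comp
        ((radial (x - a)).restrictScalars ℝ))).comp (cmul n (-Complex.I))
      = ((2 * F₁ (‖x - a‖ ^ 2) : ℝ) : ℂ) • ((Complex.I / 2) • conjCovector (radial (x - a))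
          - (Complex.I / 2) • (radial (x - a)).restrictScalars ℝ) := by
    generalize radial (x - a) = α
    ext v
    apply Complex.ext <;> simp [cmul]
    left; ring
  rw [e2, ← extMul_def, twist_extMul, twist_omegaPow (by simp), imMul_apply, e3,
    ← Complex.coe_smul]
  simp only [map_sub, map_smul, LinearMap.sub_apply, LinearMap.smul_apply]

/-- Leibniz rule applied to dᶜ: differentiating Im⟨x - a, dx⟩ gives the ω term, differentiating the
coefficient 2F₁ gives 4F₂ Re ∧ Im, that is, the β term. -/
theorem TestForm.ddc_smulConst_omegaPow {q : ℕ} {a : Cn n} {F F₁ F₂ : ℝ → ℝ}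
    (h₁ : ∀ s, HasDerivAt F (F₁ s) s) (h₂ : ∀ s, HasDerivAt F₁ (F₂ s) s)
    (f : 𝓓(Ω, ℝ)) (hf : ∀ x, f x = F (‖x - a‖ ^ 2)) (x : Cn n) :
    (TestForm.smulConst f (omegaPow n q)).ddc x
      = (2 * F₁ (‖x - a‖ ^ 2)) • omegaPow n (q + 1)
        + (2 * F₂ (‖x - a‖ ^ 2)) • mulElem (2 * q) (radial (x - a)) (omegaPow n q) := by
  have e : ((TestForm.smulConst f (omegaPow n q)).dc : Cn n → Form n (2 * q + 1))
      = fun x => (2 * F₁ (‖x - a‖ ^ 2)) • imMul (omegaPow n q) (x - a) :=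
    funext (TestForm.dc_smulConst_omegaPow h₁ f hf)
  have hd := (((h₂ (‖x - a‖ ^ 2)).comp_hasFDerivAt x (hasFDerivAt_norm_sub_sq a x)).const_mul
    2).smul ((imMul (omegaPow n q)).hasFDerivAt.comp x ((hasFDerivAt_id x).sub_const a))
  change extDeriv (TestForm.smulConst f (omegaPow n q)).dc x = _
  rw [e, extDeriv]
  erw [hd.fderiv]
  rw [ContinuousAlternatingMap.alternatizeUncurryFin_add]
  congr 1
  · rw [omegaPow_succ, ← alternatize_imMul, ← ContinuousAlternatingMap.alternatizeUncurryFin_smul]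
    rfl
  · have e2 : ((2 : ℝ) • F₂ (‖x - a‖ ^ 2) • (2 : ℝ) • Complex.reCLM.comp
          ((radial (x - a)).restrictScalars ℝ)).smulRight (imMul (omegaPow n q) (x - a))
        = (4 * F₂ (‖x - a‖ ^ 2)) • (Complex.ofRealCLM.comp (Complex.reCLM.comp
          ((radial (x - a)).restrictScalars ℝ))).smulRight (imMul (omegaPow n q) (x - a)) := by
      ext v u
      simp only [ContinuousLinearMap.smulRight_apply, smul_apply,
        ContinuousLinearMap.comp_apply, ContinuousAlternatingMap.smul_apply, smul_eq_mul,
        Complex.real_smul, Complex.ofRealCLM_apply]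
      push_cast
      ring
    refine (congrArg _ e2).trans ?_
    rw [ContinuousAlternatingMap.alternatizeUncurryFin_smul, ← extMul_def, extMul_re_imMul,
      smul_smul]
    congr 1
    ring

end

/-! ### Radial cutoff functions -/

section

/-- `∫₀ᵘ (q+1) v^q χ(v) dv`. -/
def weightedPrimitive (χ : ℝ → ℝ) (q : ℕ) (u : ℝ) : ℝ :=
  ∫ v in (0 : ℝ)..u, ((q : ℝ) + 1) * v ^ q * χ v

/-- The mean `u^{-(q+1)} ∫₀ᵘ (q+1) v^q χ(v) dv`. -/
def weightedMean (χ : ℝ → ℝ) (q : ℕ) (u : ℝ) : ℝ :=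
  -- For a cutoff equal to 1 near 0 the quotient is 1 near 0, so this value is the smooth extension.
  if u = 0 then 1 else weightedPrimitive χ q u / u ^ (q + 1)

section Calculus

variable {χ : ℝ → ℝ} {q : ℕ} {ρ' ρ : ℝ}

theorem contDiff_primitive {f F : ℝ → ℝ} (hf : ContDiff ℝ ∞ f) (hF : ∀ x, HasDerivAt F (f x) x) :
    ContDiff ℝ ∞ F := by
  rw [contDiff_infty_iff_deriv]
  refine ⟨fun x => (hF x).differentiableAt, ?_⟩
  have : deriv F = f := funext fun x => (hF x).deriv
  rwa [this]

theorem hasDerivAt_weightedPrimitive (hχ : ContDiff ℝ ∞ χ) (u : ℝ) :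
    HasDerivAt (weightedPrimitive χ q) (((q : ℝ) + 1) * u ^ q * χ u) u := by
  have hc : Continuous fun v : ℝ => ((q : ℝ) + 1) * v ^ q * χ v :=
    (continuous_const.mul (continuous_pow q)).mul hχ.continuous
  exact hc.integral_hasStrictDerivAt 0 u |>.hasDerivAt

theorem contDiff_weightedPrimitive (hχ : ContDiff ℝ ∞ χ) :
    ContDiff ℝ ∞ (weightedPrimitive χ q) :=
  contDiff_primitive ((contDiff_const.mul (contDiff_id.pow q)).mul hχ)
    (hasDerivAt_weightedPrimitive hχ)

theorem weightedPrimitive_eq_pow (h1 : ∀ u ≤ ρ', χ u = 1) (hρ' : 0 < ρ') {u : ℝ} (hu : u ≤ ρ') :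
    weightedPrimitive χ q u = u ^ (q + 1) := by
  have : weightedPrimitive χ q u = ∫ v in (0 : ℝ)..u, ((q : ℝ) + 1) * v ^ q := by
    refine intervalIntegral.integral_congr fun v hv => ?_
    have hv' : v ≤ ρ' := hv.2.trans (max_le hρ'.le hu)
    simp [h1 v hv']
  rw [this, intervalIntegral.integral_const_mul, integral_pow]
  have : (q : ℝ) + 1 ≠ 0 := by positivity
  field_simp
  simp

theorem weightedPrimitive_eq_of_le (hχ : ContDiff ℝ ∞ χ) (h0 : ∀ u, ρ ≤ u → χ u = 0)
    {u : ℝ} (hu : ρ ≤ u) :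
    weightedPrimitive χ q u = weightedPrimitive χ q ρ := by
  have hc : Continuous fun v : ℝ => ((q : ℝ) + 1) * v ^ q * χ v :=
    (continuous_const.mul (continuous_pow q)).mul hχ.continuous
  have h := intervalIntegral.integral_interval_sub_left (hc.intervalIntegrable (μ := volume) 0 u)
    (hc.intervalIntegrable 0 ρ)
  have h' : ∫ v in ρ..u, ((q : ℝ) + 1) * v ^ q * χ v = 0 := by
    refine (intervalIntegral.integral_congr (g := fun _ => (0 : ℝ)) fun v hv => ?_).trans (by simp)
    rw [uIcc_of_le hu] at hv
    simp [h0 v hv.1]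
  rw [h'] at h
  exact sub_eq_zero.1 h

theorem weightedPrimitive_monotoneOn (hχ : ContDiff ℝ ∞ χ) (hnn : ∀ u, 0 ≤ χ u) :
    MonotoneOn (weightedPrimitive χ q) (Ici 0) := by
  refine monotoneOn_of_deriv_nonneg (convex_Ici 0)
    (contDiff_weightedPrimitive hχ).continuous.continuousOn
    (fun x _ => (hasDerivAt_weightedPrimitive hχ x).differentiableAt.differentiableWithinAt) ?_
  intro x hx
  rw [interior_Ici, mem_Ioi] at hx
  rw [(hasDerivAt_weightedPrimitive hχ x).deriv]
  have := hnn x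
  positivity

/-- The derivative is u^{q+1} χ'(u) ≤ 0. This gives the sign of the second derivative of the
comparison function. -/
theorem pow_mul_sub_weightedPrimitive_antitoneOn (hχ : ContDiff ℝ ∞ χ) (hanti : Antitone χ) :
    AntitoneOn (fun u => u ^ (q + 1) * χ u - weightedPrimitive χ q u) (Ici 0) := by
  have hd : ∀ x, HasDerivAt (fun u => u ^ (q + 1) * χ u - weightedPrimitive χ q u)
      (x ^ (q + 1) * deriv χ x) x := by
    intro x
    have h := (((hasDerivAt_pow (q + 1) x).mul
      ((hχ.differentiable (by simp)) x).hasDerivAt).sub (hasDerivAt_weightedPrimitive (q := q) hχ x))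
    refine h.congr_deriv ?_
    push_cast
    simp
  refine antitoneOn_of_deriv_nonpos (convex_Ici 0)
    (fun x _ => (hd x).continuousAt.continuousWithinAt)
    (fun x _ => (hd x).differentiableAt.differentiableWithinAt) ?_
  intro x hx
  rw [interior_Ici, mem_Ioi] at hx
  rw [(hd x).deriv]
  exact mul_nonpos_of_nonneg_of_nonpos (by positivity) hanti.deriv_nonpos

theorem weightedMean_eq_one (h1 : ∀ u ≤ ρ', χ u = 1) (hρ' : 0 < ρ') {u : ℝ} (hu : u ≤ ρ') :
    weightedMean χ q u = 1 := by
  unfold weightedMean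
  split_ifs with h
  · rfl
  · rw [weightedPrimitive_eq_pow h1 hρ' hu, div_self (pow_ne_zero _ h)]

theorem pow_mul_weightedMean (u : ℝ) :
    u ^ (q + 1) * weightedMean χ q u = weightedPrimitive χ q u := by
  unfold weightedMean
  split_ifs with h
  · subst h; simp [weightedPrimitive]
  · field_simp

theorem weightedMean_eventuallyEq_one (h1 : ∀ u ≤ ρ', χ u = 1) (hρ' : 0 < ρ') {u : ℝ}
    (hu : u < ρ') : weightedMean χ q =ᶠ[𝓝 u] fun _ => 1 := by
  filter_upwards [Iio_mem_nhds hu] with v hv using weightedMean_eq_one h1 hρ' (le_of_lt hv)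

theorem contDiff_weightedMean (hχ : ContDiff ℝ ∞ χ) (h1 : ∀ u ≤ ρ', χ u = 1) (hρ' : 0 < ρ') :
    ContDiff ℝ ∞ (weightedMean χ q) := by
  rw [contDiff_iff_contDiffAt]
  intro u
  rcases lt_or_ge u ρ' with hu | hu
  · exact contDiffAt_const.congr_of_eventuallyEq (weightedMean_eventuallyEq_one h1 hρ' hu)
  · have hu0 : u ≠ 0 := (hρ'.trans_le hu).ne'
    have h : ContDiffAt ℝ ∞ (fun u => weightedPrimitive χ q u / u ^ (q + 1)) u :=
      (contDiff_weightedPrimitive hχ).contDiffAt.div (contDiff_id.pow _).contDiffAt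
        (pow_ne_zero _ hu0)
    refine h.congr_of_eventuallyEq ?_
    filter_upwards [isOpen_ne.mem_nhds hu0] with v hv
    exact if_neg hv

/-- Differentiate u^{q+1} Y = P, with Y the mean and P the primitive, and cancel u^q. At u = 0 both
sides vanish. -/
theorem mul_deriv_weightedMean (hχ : ContDiff ℝ ∞ χ) (h1 : ∀ u ≤ ρ', χ u = 1) (hρ' : 0 < ρ')
    (u : ℝ) :
    u * deriv (weightedMean χ q) u = ((q : ℝ) + 1) * (χ u - weightedMean χ q u) := by
  rcases eq_or_ne u 0 with rfl | hu
  · simp [h1 0 hρ'.le, weightedMean]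
  · have hY := ((contDiff_weightedMean (q := q) hχ h1 hρ').differentiable (by simp) u).hasDerivAt
    have hX := (hasDerivAt_pow (q + 1) u).mul hY
    have e : (fun u => u ^ (q + 1)) * weightedMean χ q = weightedPrimitive χ q :=
      funext pow_mul_weightedMean
    rw [e] at hX
    have := hX.unique (hasDerivAt_weightedPrimitive hχ u)
    have hq : u ^ q ≠ 0 := pow_ne_zero _ hu
    apply mul_left_cancel₀ hq
    push_cast at this
    linear_combination this

/-- The radial function whose `ddᶜ` compares the cutoffs at the scales `t₁ ≤ t₂`. -/
theorem exists_radial_comparison (hχ : ContDiff ℝ ∞ χ) (hanti : Antitone χ)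
    (h1 : ∀ u ≤ ρ', χ u = 1) (hρ' : 0 < ρ') (h0 : ∀ u, ρ ≤ u → χ u = 0)
    {t₁ t₂ : ℝ} (ht₁ : 0 < t₁) (ht : t₁ ≤ t₂) (q : ℕ) :
    ∃ H H₁ H₂ : ℝ → ℝ, ContDiff ℝ ∞ H ∧ (∀ s, HasDerivAt H (H₁ s) s) ∧
      (∀ s, HasDerivAt H₁ (H₂ s) s) ∧ (∀ s, ρ * t₂ ≤ s → H s = 0) ∧ (∀ s, 0 ≤ s → 0 ≤ H s) ∧
      (∀ s, 0 ≤ s → 0 ≤ H₂ s) ∧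
      ∀ s, ((q : ℝ) + 1) * ((t₂ ^ (q + 1))⁻¹ * χ (s / t₂) - (t₁ ^ (q + 1))⁻¹ * χ (s / t₁) - H₁ s)
        = s * H₂ s := by
  have ht₂ : 0 < t₂ := ht₁.trans_le ht
  have hnn : ∀ u, 0 ≤ χ u := fun u => by
    rcases le_total ρ u with h | h
    · exact (h0 u h).ge
    · exact (h0 ρ le_rfl).ge.trans (hanti h)
  have hρ : 0 < ρ := by
    by_contra! h
    have a1 := h1 0 hρ'.le
    rw [h0 0 h] at a1
    exact zero_ne_one a1
  set Y := weightedMean χ q with hY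
  have hYs : ContDiff ℝ ∞ Y := contDiff_weightedMean hχ h1 hρ'
  -- With g the difference of the normalised cutoffs, the required identity reads (s^{q+1} H₁)' =
  -- (q+1) s^q g. Its solution regular at 0 is the weighted mean of g, which by scaling is this
  -- difference of means.
  set H₁ : ℝ → ℝ := fun s => (t₂ ^ (q + 1))⁻¹ * Y (s / t₂) - (t₁ ^ (q + 1))⁻¹ * Y (s / t₁) with hH₁
  have hH₁s : ContDiff ℝ ∞ H₁ :=
    (contDiff_const.mul (hYs.comp (contDiff_id.div_const _))).sub
      (contDiff_const.mul (hYs.comp (contDiff_id.div_const _)))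
  set H₂ : ℝ → ℝ := fun s => (t₂ ^ (q + 1))⁻¹ * (deriv Y (s / t₂) * (1 / t₂))
    - (t₁ ^ (q + 1))⁻¹ * (deriv Y (s / t₁) * (1 / t₁)) with hH₂
  -- Integrating from ρ t₂ makes the primitive vanish beyond that point.
  have hHd : ∀ s, HasDerivAt (fun s => ∫ v in (ρ * t₂)..s, H₁ v) (H₁ s) s := fun s =>
    (hH₁s.continuous.integral_hasStrictDerivAt _ s).hasDerivAt
  have hid : ∀ s, ((q : ℝ) + 1) * ((t₂ ^ (q + 1))⁻¹ * χ (s / t₂) - (t₁ ^ (q + 1))⁻¹ * χ (s / t₁)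
      - H₁ s) = s * H₂ s := by
    intro s
    have e1 := mul_deriv_weightedMean (q := q) hχ h1 hρ' (s / t₁)
    have e2 := mul_deriv_weightedMean (q := q) hχ h1 hρ' (s / t₂)
    rw [← hY] at e1 e2
    simp only [hH₁, hH₂]
    linear_combination (t₁ ^ (q + 1))⁻¹ * e1 - (t₂ ^ (q + 1))⁻¹ * e2
  have hpow : ∀ s, s ^ (q + 1) * H₁ s
      = weightedPrimitive χ q (s / t₂) - weightedPrimitive χ q (s / t₁) := by
    intro s
    rw [← pow_mul_weightedMean, ← pow_mul_weightedMean, ← hY, div_pow, div_pow]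
    simp only [hH₁]
    ring
  have hle : ∀ s, 0 ≤ s → s / t₂ ≤ s / t₁ := fun s hs => by gcongr
  have hH₁np : ∀ s, 0 ≤ s → H₁ s ≤ 0 := by
    intro s hs
    rcases hs.eq_or_lt with rfl | hs
    · have : (t₂ ^ (q + 1))⁻¹ ≤ (t₁ ^ (q + 1))⁻¹ := by gcongr
      simpa [hH₁, hY, weightedMean] using this
    · have h := weightedPrimitive_monotoneOn (q := q) hχ hnn (mem_Ici.2 (by positivity))
        (mem_Ici.2 (by positivity)) (hle s hs.le)
      have h' : s ^ (q + 1) * H₁ s ≤ 0 := by rw [hpow]; linarith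
      exact nonpos_of_mul_nonpos_right h' (by positivity)
  have hH₁z : ∀ s, ρ * t₂ ≤ s → H₁ s = 0 := by
    intro s hs
    have hs0 : 0 < s := lt_of_lt_of_le (by positivity) hs
    have h2 : ρ ≤ s / t₂ := by rwa [le_div_iff₀ ht₂]
    have h' : s ^ (q + 1) * H₁ s = 0 := by
      -- Both rescaled primitives have reached the same final value. The normalisations t^{-(q+1)}
      -- are what make these values agree.
      rw [hpow, weightedPrimitive_eq_of_le hχ h0 h2,
        weightedPrimitive_eq_of_le hχ h0 (h2.trans (hle s hs0.le)), sub_self]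
    exact (mul_eq_zero.1 h').resolve_left (by positivity)
  have hHz : ∀ s, ρ * t₂ ≤ s → ∫ v in (ρ * t₂)..s, H₁ v = 0 := by
    intro s hs
    refine (intervalIntegral.integral_congr (g := fun _ => (0 : ℝ)) fun v hv => ?_).trans (by simp)
    rw [uIcc_of_le hs] at hv
    exact hH₁z v hv.1
  refine ⟨fun s => ∫ v in (ρ * t₂)..s, H₁ v, H₁, H₂, contDiff_primitive hH₁s hHd, hHd, ?_, hHz,
    ?_, ?_, hid⟩
  · intro s
    have hYd : ∀ u, HasDerivAt Y (deriv Y u) u := fun u =>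
      (hYs.differentiable (by simp) u).hasDerivAt
    exact (((hYd (s / t₂)).comp s ((hasDerivAt_id s).div_const t₂)).const_mul _).sub
      (((hYd (s / t₁)).comp s ((hasDerivAt_id s).div_const t₁)).const_mul _)
  · intro s hs
    rcases le_total (ρ * t₂) s with h | h
    · exact (hHz s h).ge
    · change 0 ≤ ∫ v in (ρ * t₂)..s, H₁ v
      rw [intervalIntegral.integral_symm, ← intervalIntegral.integral_neg]
      exact intervalIntegral.integral_nonneg h fun u hu => neg_nonneg.2 (hH₁np u (hs.trans hu.1))
  · intro s hs
    rcases hs.eq_or_lt with rfl | hs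
    · have : deriv Y 0 = 0 := by
        rw [(weightedMean_eventuallyEq_one h1 hρ' hρ').deriv_eq]; simp
      simp [hH₂, this]
    · have h := pow_mul_sub_weightedPrimitive_antitoneOn (q := q) hχ hanti
        (mem_Ici.2 (by positivity)) (mem_Ici.2 (by positivity)) (hle s hs.le)
      -- Up to the factor q + 1, this is the difference of one antitone function at the points s/t₂
      -- ≤ s/t₁, hence nonnegative.
      have h' : s ^ (q + 1) * (s * H₂ s) = ((q : ℝ) + 1) *
          (((s / t₂) ^ (q + 1) * χ (s / t₂) - weightedPrimitive χ q (s / t₂))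
            - ((s / t₁) ^ (q + 1) * χ (s / t₁) - weightedPrimitive χ q (s / t₁))) := by
        rw [← hid, div_pow, div_pow]
        linear_combination (-((q : ℝ) + 1)) * hpow s
      have h'' : 0 ≤ s ^ (q + 1) * (s * H₂ s) := by
        rw [h']
        exact mul_nonneg (by positivity) (sub_nonneg.2 h)
      exact nonneg_of_mul_nonneg_right (nonneg_of_mul_nonneg_right h'' (by positivity)) hs

/-- A smooth decreasing cutoff function, `1` up to `ρ'` and `0` from `ρ` on. -/
theorem exists_antitone_cutoff (h : ρ' < ρ) :
    ∃ χ : ℝ → ℝ, ContDiff ℝ ∞ χ ∧ Antitone χ ∧ (∀ u ≤ ρ', χ u = 1) ∧ (∀ u, ρ ≤ u → χ u = 0) ∧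
      ∀ u, 0 ≤ χ u ∧ χ u ≤ 1 := by
  have hd : 0 < ρ - ρ' := sub_pos.2 h
  refine ⟨fun u => Real.smoothTransition ((ρ - u) / (ρ - ρ')), ?_, ?_, ?_, ?_, ?_⟩
  · exact Real.smoothTransition.contDiff.comp ((contDiff_const.sub contDiff_id).div_const _)
  · intro u v huv
    apply Real.smoothTransition.monotone
    gcongr
  · intro u hu
    apply Real.smoothTransition.one_of_one_le
    rw [le_div_iff₀ hd]
    linarith
  · intro u hu
    apply Real.smoothTransition.zero_of_nonpos
    exact div_nonpos_of_nonpos_of_nonneg (by linarith) hd.le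
  · exact fun u => ⟨Real.smoothTransition.nonneg _, Real.smoothTransition.le_one _⟩

end Calculus

end

/-! ### Monotonicity of the mass ratios -/

section

variable {n : ℕ} {Ω : Opens (Cn n)}

theorem tsupport_radial_subset (a : Cn n) {F : ℝ → ℝ} {c : ℝ} (h0 : ∀ s, c ≤ s → F s = 0) :
    tsupport (fun x : Cn n => F (‖x - a‖ ^ 2)) ⊆ {x | ‖x - a‖ ^ 2 ≤ c} := by
  refine closure_minimal (fun x hx => ?_) (isClosed_le (by fun_prop) continuous_const)
  by_contra h
  exact hx (h0 _ (not_le.1 h).le)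

/-- The test function `x ↦ F (|x - a|²)`. -/
def radialTest (a : Cn n) {F : ℝ → ℝ} (hF : ContDiff ℝ ∞ F) {c : ℝ}
    (h0 : ∀ s, c ≤ s → F s = 0) (hc : ∀ x : Cn n, ‖x - a‖ ^ 2 ≤ c → x ∈ Ω) : 𝓓(Ω, ℝ) where
  toFun x := F (‖x - a‖ ^ 2)
  contDiff' := hF.comp ((contDiff_id.sub contDiff_const).norm_sq ℂ)
  hasCompactSupport' := by
    refine (isCompact_closedBall a (√c)).of_isClosed_subset (isClosed_tsupport _)
      ((tsupport_radial_subset a h0).trans fun x hx => ?_)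
    rw [mem_closedBall_iff_norm]
    exact Real.le_sqrt_of_sq_le hx
  tsupport_subset' := (tsupport_radial_subset a h0).trans hc

@[simp]
theorem radialTest_apply (a : Cn n) {F : ℝ → ℝ} (hF : ContDiff ℝ ∞ F) {c : ℝ}
    (h0 : ∀ s, c ≤ s → F s = 0) (hc : ∀ x : Cn n, ‖x - a‖ ^ 2 ≤ c → x ∈ Ω) (x : Cn n) :
    radialTest a hF h0 hc x = F (‖x - a‖ ^ 2) := rfl

namespace LocalCurrent

/-- `Re ⟨T, f ωᵖ⟩`. -/
def traceIntegral {p : ℕ} (T : LocalCurrent Ω (2 * p)) (f : 𝓓(Ω, ℝ)) : ℝ :=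
  (T (TestForm.smulConst f (omegaPow n p))).re

theorem IsPositive.traceIntegral_mono {p : ℕ} {T : LocalCurrent Ω (2 * p)} (hT : T.IsPositive)
    {f g : 𝓓(Ω, ℝ)} (h : ∀ x, f x ≤ g x) : T.traceIntegral f ≤ T.traceIntegral g := by
  have h1 := hT (TestForm.smulConst g (omegaPow n p) - TestForm.smulConst f (omegaPow n p))
    fun x => by
      change g x • omegaPow n p - f x • omegaPow n p ∈ _
      rw [← sub_smul]
      exact smul_mem_stronglyPositive (sub_nonneg.2 (h x)) (omegaPow_mem_stronglyPositive n p)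
  rw [map_sub] at h1
  have := (Complex.nonneg_iff.1 h1).1
  rw [Complex.sub_re] at this
  exact sub_nonneg.1 this

theorem traceIntegral_add {p : ℕ} (T : LocalCurrent Ω (2 * p)) (f g : 𝓓(Ω, ℝ)) :
    T.traceIntegral (f + g) = T.traceIntegral f + T.traceIntegral g := by
  have : TestForm.smulConst (f + g) (omegaPow n p)
      = TestForm.smulConst f (omegaPow n p) + TestForm.smulConst g (omegaPow n p) := by
    ext1 x
    exact add_smul (f x) (g x) (omegaPow n p)
  rw [traceIntegral, this, map_add, Complex.add_re]
  rfl

theorem IsPositive.traceIntegral_nonneg {p : ℕ} {T : LocalCurrent Ω (2 * p)} (hT : T.IsPositive)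
    {f : 𝓓(Ω, ℝ)} (h : ∀ x, 0 ≤ f x) : 0 ≤ T.traceIntegral f :=
  (Complex.nonneg_iff.1 (hT _ fun x =>
    smul_mem_stronglyPositive (h x) (omegaPow_mem_stronglyPositive n p))).1

/-- The difference of the two sides splits into ½⟨T, ddᶜ(h ω^q)⟩, nonnegative by plurisubharmonicity
since h ≥ 0, and the value of `T` on a strongly positive form. -/
theorem traceIntegral_cutoff_mono {q : ℕ} {T : LocalCurrent Ω (2 * (q + 1))} (hT : T.IsPositive)
    (hT' : T.IsPlurisubharmonic) {χ : ℝ → ℝ} {ρ' ρ : ℝ} (hχ : ContDiff ℝ ∞ χ) (hanti : Antitone χ)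
    (h1 : ∀ u ≤ ρ', χ u = 1) (hρ' : 0 < ρ') (h0 : ∀ u, ρ ≤ u → χ u = 0)
    {t₁ t₂ : ℝ} (ht₁ : 0 < t₁) (ht : t₁ ≤ t₂) {a : Cn n}
    (hΩ : ∀ x : Cn n, ‖x - a‖ ^ 2 ≤ ρ * t₂ → x ∈ Ω) {f₁ f₂ : 𝓓(Ω, ℝ)}
    (hf₁ : ∀ x, f₁ x = χ (‖x - a‖ ^ 2 / t₁)) (hf₂ : ∀ x, f₂ x = χ (‖x - a‖ ^ 2 / t₂)) :
    (t₁ ^ (q + 1))⁻¹ * T.traceIntegral f₁ ≤ (t₂ ^ (q + 1))⁻¹ * T.traceIntegral f₂ := by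
  obtain ⟨H, H₁, H₂, hH, hHd, hHd', hH0, hHnn, hH₂nn, hid⟩ :=
    exists_radial_comparison hχ hanti h1 hρ' h0 ht₁ ht q
  set h : 𝓓(Ω, ℝ) := radialTest a hH hH0 hΩ with hh
  set c₁ : ℝ := (t₁ ^ (q + 1))⁻¹ with hc₁
  set c₂ : ℝ := (t₂ ^ (q + 1))⁻¹ with hc₂
  set w₁ : TestForm Ω (2 * (q + 1)) := TestForm.smulConst f₁ (omegaPow n (q + 1)) with hw₁
  set w₂ : TestForm Ω (2 * (q + 1)) := TestForm.smulConst f₂ (omegaPow n (q + 1)) with hw₂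
  set w₃ : TestForm Ω (2 * (q + 1)) := (TestForm.smulConst h (omegaPow n q)).ddc with hw₃
  have hpsh : 0 ≤ T w₃ := hT' (TestForm.smulConst h (omegaPow n q)) fun x =>
    smul_mem_stronglyPositive (hHnn _ (by positivity)) (omegaPow_mem_stronglyPositive n q)
  have hpos : 0 ≤ T ((c₂ : ℂ) • w₂ - (c₁ : ℂ) • w₁ - (1 / 2 : ℂ) • w₃) := by
    refine hT _ fun x => ?_
    have e3 : w₃ x = (2 * H₁ (‖x - a‖ ^ 2)) • omegaPow n (q + 1)
        + (2 * H₂ (‖x - a‖ ^ 2)) • mulElem (2 * q) (radial (x - a)) (omegaPow n q) :=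
      TestForm.ddc_smulConst_omegaPow hHd hHd' h (fun _ => rfl) x
    have e : ((c₂ : ℂ) • w₂ - (c₁ : ℂ) • w₁ - (1 / 2 : ℂ) • w₃) x
        = (c₂ : ℂ) • (f₂ x • omegaPow n (q + 1)) - (c₁ : ℂ) • (f₁ x • omegaPow n (q + 1))
          - (1 / 2 : ℂ) • w₃ x := rfl
    -- The coefficient of ω^{q+1} is turned into s H₂/(q+1) by the differential identity for H,
    -- which leaves a nonnegative multiple of the Cauchy-Schwarz form.
    have key : ((c₂ : ℂ) • w₂ - (c₁ : ℂ) • w₁ - (1 / 2 : ℂ) • w₃) x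
        = (H₂ (‖x - a‖ ^ 2) / ((q : ℝ) + 1)) • (‖x - a‖ ^ 2 • omegaPow n (q + 1)
          - ((q : ℝ) + 1) • mulElem (2 * q) (radial (x - a)) (omegaPow n q)) := by
      have hq : (q : ℝ) + 1 ≠ 0 := by positivity
      have hs : c₂ * f₂ x - c₁ * f₁ x - H₁ (‖x - a‖ ^ 2)
          = H₂ (‖x - a‖ ^ 2) / ((q : ℝ) + 1) * ‖x - a‖ ^ 2 := by
        rw [hf₁, hf₂]
        field_simp
        linear_combination hid (‖x - a‖ ^ 2)
      have hhalf : (1 / 2 : ℂ) = ((1 / 2 : ℝ) : ℂ) := by push_cast; rfl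
      rw [e, e3, hhalf, Complex.coe_smul, Complex.coe_smul, Complex.coe_smul]
      have hr : (H₂ (‖x - a‖ ^ 2) / ((q : ℝ) + 1)) • (‖x - a‖ ^ 2 • omegaPow n (q + 1)
            - ((q : ℝ) + 1) • mulElem (2 * q) (radial (x - a)) (omegaPow n q))
          = (c₂ * f₂ x - c₁ * f₁ x - H₁ (‖x - a‖ ^ 2)) • omegaPow n (q + 1)
            - H₂ (‖x - a‖ ^ 2) • mulElem (2 * q) (radial (x - a)) (omegaPow n q) := by
        rw [smul_sub, smul_smul, smul_smul, ← hs, div_mul_cancel₀ _ hq]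
      rw [hr]
      module
    rw [key]
    exact smul_mem_stronglyPositive (div_nonneg (hH₂nn _ (by positivity)) (by positivity))
      (sub_mulElem_radial_mem_stronglyPositive (x - a) q)
  rw [map_sub, map_sub, map_smul, map_smul, map_smul] at hpos
  have r1 := (Complex.nonneg_iff.1 hpos).1
  have r2 := (Complex.nonneg_iff.1 hpsh).1
  have hhalf : (1 / 2 : ℂ) = ((1 / 2 : ℝ) : ℂ) := by push_cast; rfl
  rw [hhalf] at r1
  simp only [smul_eq_mul, Complex.sub_re, Complex.re_ofReal_mul] at r1
  change c₁ * (T w₁).re ≤ c₂ * (T w₂).re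
  linarith

/-! ### From smooth cutoffs to balls -/

theorem traceMass_mono {p : ℕ} (T : LocalCurrent Ω (2 * p)) {U U' : Set (Cn n)} (h : U ⊆ U') :
    T.traceMass U ≤ T.traceMass U' :=
  iSup_mono fun _ => iSup_mono fun _ => iSup_mono' fun h' => ⟨h'.trans h, le_rfl⟩

theorem le_traceMass {p : ℕ} (T : LocalCurrent Ω (2 * p)) {U : Set (Cn n)} {f : 𝓓(Ω, ℝ)}
    (h : ∀ x, 0 ≤ f x ∧ f x ≤ 1) (hU : tsupport f ⊆ U) :
    ENNReal.ofReal (T.traceIntegral f) ≤ T.traceMass U :=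
  le_iSup_of_le f (le_iSup_of_le h (le_iSup_of_le hU le_rfl))

theorem traceMass_le {p : ℕ} {T : LocalCurrent Ω (2 * p)} {U : Set (Cn n)} {M : ℝ≥0∞}
    (h : ∀ f : 𝓓(Ω, ℝ), (∀ x, 0 ≤ f x ∧ f x ≤ 1) → tsupport f ⊆ U →
      ENNReal.ofReal (T.traceIntegral f) ≤ M) : T.traceMass U ≤ M :=
  iSup_le fun f => iSup_le fun hf => iSup_le fun hU => h f hf hU

/-- Radial cutoffs dominating the functions supported in a ball. -/
theorem exists_cutoff_ge {a : Cn n} {r : ℝ} (hr : 0 < r) {K : Set (Cn n)} (hK : IsClosed K)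
    (h : K ⊆ Metric.ball a r) :
    ∃ (χ : ℝ → ℝ) (ρ' ρ : ℝ), 0 < ρ' ∧ 0 < ρ ∧ ρ < 1 ∧ ContDiff ℝ ∞ χ ∧ Antitone χ ∧
      (∀ u ≤ ρ', χ u = 1) ∧ (∀ u, ρ ≤ u → χ u = 0) ∧ (∀ u, 0 ≤ χ u ∧ χ u ≤ 1) ∧
      ∀ x ∈ K, χ (‖x - a‖ ^ 2 / r ^ 2) = 1 := by
  obtain ⟨r', ⟨hr'0, hr'⟩, hK'⟩ := exists_pos_lt_subset_ball hr hK h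
  have hlt : (r' / r) ^ 2 < 1 := by
    rw [sq_lt_one_iff₀ (by positivity), div_lt_one hr]
    exact hr'
  obtain ⟨ρ, hρ1, hρ2⟩ := exists_between hlt
  have hpos : 0 < (r' / r) ^ 2 := by positivity
  obtain ⟨χ, hχ, hanti, h1, h0, hnn⟩ := exists_antitone_cutoff hρ1
  refine ⟨χ, (r' / r) ^ 2, ρ, hpos, hpos.trans hρ1, hρ2, hχ, hanti, h1, h0, hnn, fun x hx => ?_⟩
  apply h1
  rw [← div_pow]
  have := (mem_ball_iff_norm.1 (hK' hx)).le
  gcongr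

theorem mem_of_norm_sq_le {a : Cn n} {r ρ : ℝ} (hr : 0 < r) (hρ : ρ < 1)
    (x : Cn n) (hx : ‖x - a‖ ^ 2 ≤ ρ * r ^ 2) :
    x ∈ Metric.ball a r := by
  rw [mem_ball_iff_norm]
  refine lt_of_pow_lt_pow_left₀ 2 hr.le (hx.trans_lt ?_)
  nlinarith [pow_pos hr 2]

/-- A test function supported in the small ball lies below a radial cutoff χ(|x - a|²/r₁²). The same
profile at scale r₂ is admissible for the large ball, so the cutoff inequality applies with t = r².
-/
theorem traceMass_ball_le {q : ℕ} {T : LocalCurrent Ω (2 * (q + 1))} (hT : T.IsPositive)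
    (hT' : T.IsPlurisubharmonic) {a : Cn n} {r₁ r₂ : ℝ} (hr₁ : 0 < r₁) (hr : r₁ ≤ r₂)
    (hΩ : Metric.ball a r₂ ⊆ Ω) :
    T.traceMass (Metric.ball a r₁)
      ≤ ENNReal.ofReal ((r₁ / r₂) ^ (2 * (q + 1))) * T.traceMass (Metric.ball a r₂) := by
  have hr₂ := hr₁.trans_le hr
  refine traceMass_le fun f hf hfU => ?_
  obtain ⟨χ, ρ', ρ, hρ', hρ, hρ1, hχ, hanti, h1, h0, hnn, hK⟩ :=
    exists_cutoff_ge hr₁ (isClosed_tsupport f) hfU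
  have hsm : ∀ t : ℝ, ContDiff ℝ ∞ fun s => χ (s / t) := fun t =>
    hχ.comp (contDiff_id.div_const t)
  have hz : ∀ t : ℝ, 0 < t → ∀ s, ρ * t ≤ s → χ (s / t) = 0 := fun t ht s hs =>
    h0 _ (by rwa [le_div_iff₀ ht])
  have hm₁ := mem_of_norm_sq_le (a := a) hr₁ hρ1
  have hm₂ := mem_of_norm_sq_le (a := a) hr₂ hρ1
  set f₁ : 𝓓(Ω, ℝ) := radialTest a (hsm (r₁ ^ 2)) (hz _ (by positivity))
    fun x hx => hΩ (Metric.ball_subset_ball hr (hm₁ x hx)) with hf₁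
  set f₂ : 𝓓(Ω, ℝ) := radialTest a (hsm (r₂ ^ 2)) (hz _ (by positivity))
    fun x hx => hΩ (hm₂ x hx) with hf₂
  have i1 : T.traceIntegral f ≤ T.traceIntegral f₁ := by
    refine hT.traceIntegral_mono fun x => ?_
    by_cases hx : x ∈ tsupport f
    · rw [hf₁, radialTest_apply, hK x hx]
      exact (hf x).2
    · rw [image_eq_zero_of_notMem_tsupport hx]
      exact (hnn _).1
  have i2 := traceIntegral_cutoff_mono hT hT' hχ hanti h1 hρ' h0 (a := a) (t₁ := r₁ ^ 2)
    (t₂ := r₂ ^ 2) (by positivity) (by gcongr) (fun x hx => hΩ (hm₂ x hx)) (f₁ := f₁) (f₂ := f₂)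
    (fun _ => rfl) (fun _ => rfl)
  have i3 : ENNReal.ofReal (T.traceIntegral f₂) ≤ T.traceMass (Metric.ball a r₂) :=
    T.le_traceMass (fun x => hnn _)
      ((tsupport_radial_subset a (hz _ (by positivity))).trans hm₂)
  have i4 : T.traceIntegral f₁ ≤ (r₁ / r₂) ^ (2 * (q + 1)) * T.traceIntegral f₂ := by
    rw [← pow_mul, ← pow_mul, inv_mul_le_iff₀ (by positivity)] at i2
    refine i2.trans_eq ?_
    rw [div_pow]
    ring
  calc ENNReal.ofReal (T.traceIntegral f)
      ≤ ENNReal.ofReal ((r₁ / r₂) ^ (2 * (q + 1)) * T.traceIntegral f₂) :=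
        ENNReal.ofReal_le_ofReal (i1.trans i4)
    _ = ENNReal.ofReal ((r₁ / r₂) ^ (2 * (q + 1))) * ENNReal.ofReal (T.traceIntegral f₂) :=
        ENNReal.ofReal_mul (by positivity)
    _ ≤ _ := by gcongr

theorem massRatio_mono {p : ℕ} {T : LocalCurrent Ω (2 * p)} (hT : T.IsPositive)
    (hT' : T.IsPlurisubharmonic) {a : Cn n} {r₁ r₂ : ℝ} (hr₁ : 0 < r₁) (hr : r₁ ≤ r₂)
    (hΩ : Metric.ball a r₂ ⊆ Ω) : T.massRatio a r₁ ≤ T.massRatio a r₂ := by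
  have hr₂ := hr₁.trans_le hr
  rcases p with _ | q
  -- For p = 0 the denominator is 1 and the ratio is the mass itself.
  · simp only [massRatio, pow_zero, mul_zero, mul_one]
    gcongr
    exact T.traceMass_mono (Metric.ball_subset_ball hr)
  · have hc : (0 : ℝ) < 2 ^ (q + 1) * Real.pi ^ (q + 1) := by positivity
    unfold massRatio
    refine ENNReal.div_le_of_le_mul ((traceMass_ball_le hT hT' hr₁ hr hΩ).trans_eq ?_)
    have e : (r₁ / r₂) ^ (2 * (q + 1)) = (2 ^ (q + 1) * Real.pi ^ (q + 1) * r₁ ^ (2 * (q + 1)))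
        / (2 ^ (q + 1) * Real.pi ^ (q + 1) * r₂ ^ (2 * (q + 1))) := by
      rw [div_pow, mul_div_mul_left _ _ hc.ne']
    rw [e, ENNReal.ofReal_div_of_pos (by positivity), div_eq_mul_inv, div_eq_mul_inv]
    ring

theorem traceMass_ball_lt_top {p : ℕ} {T : LocalCurrent Ω (2 * p)} (hT : T.IsPositive)
    {a : Cn n} {r R : ℝ} (hR : 0 < R) (hr : r < R) (hΩ : Metric.ball a R ⊆ Ω) :
    T.traceMass (Metric.ball a r) < ⊤ := by
  obtain ⟨χ, ρ', ρ, hρ', hρ, hρ1, hχ, hanti, h1, h0, hnn, hK⟩ :=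
    exists_cutoff_ge hR Metric.isClosed_closedBall (Metric.closedBall_subset_ball hr : _ ⊆ Metric.ball a R)
  have hm := mem_of_norm_sq_le (a := a) hR hρ1
  set g : 𝓓(Ω, ℝ) := radialTest a (F := fun s => χ (s / R ^ 2)) (c := ρ * R ^ 2)
    (hχ.comp (contDiff_id.div_const _)) (fun s hs => h0 _ (by rwa [le_div_iff₀ (by positivity)]))
    (fun x hx => hΩ (hm x hx)) with hg
  refine lt_of_le_of_lt (b := ENNReal.ofReal (T.traceIntegral g)) ?_ ENNReal.ofReal_lt_top
  refine traceMass_le fun f hf hfU => ENNReal.ofReal_le_ofReal (hT.traceIntegral_mono fun x => ?_)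
  by_cases hx : x ∈ tsupport f
  · rw [hg, radialTest_apply, hK x (Metric.ball_subset_closedBall (hfU hx))]
    exact (hf x).2
  · rw [image_eq_zero_of_notMem_tsupport hx]
    exact (hnn _).1

end LocalCurrent

end

/-! ### Lelong numbers and their level sets -/

section

namespace LocalCurrent

variable {n p : ℕ} {Ω : Opens (Cn n)} {T : LocalCurrent Ω (2 * p)}

theorem exists_tendsto_massRatio (hT : T.IsPositive) (hT' : T.IsPlurisubharmonic) {a : Cn n}
    (ha : a ∈ Ω) : ∃ l : ℝ≥0∞, Tendsto (T.massRatio a) (𝓝[>] (0 : ℝ)) (𝓝 l) := by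
  obtain ⟨R, hR, hΩ⟩ := Metric.isOpen_iff.1 Ω.isOpen a ha
  refine ⟨_, MonotoneOn.tendsto_nhdsWithin_Ioo_right (nonempty_Ioo.2 hR) (fun r hr s hs hrs => ?_)
    (OrderBot.bddBelow _)⟩
  exact massRatio_mono hT hT' hr.1 hrs ((Metric.ball_subset_ball hs.2.le).trans hΩ)

theorem tendsto_massRatio (hT : T.IsPositive) (hT' : T.IsPlurisubharmonic) {a : Cn n}
    (ha : a ∈ Ω) : Tendsto (T.massRatio a) (𝓝[>] (0 : ℝ)) (𝓝 (T.lelong a)) := by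
  obtain ⟨l, hl⟩ := exists_tendsto_massRatio hT hT' ha
  rwa [lelong, hl.limUnder_eq]

theorem lelong_le_massRatio (hT : T.IsPositive) (hT' : T.IsPlurisubharmonic) {a : Cn n} {r : ℝ}
    (hr : 0 < r) (hΩ : Metric.ball a r ⊆ Ω) : T.lelong a ≤ T.massRatio a r := by
  refine le_of_tendsto (tendsto_massRatio hT hT' (hΩ (Metric.mem_ball_self hr))) ?_
  filter_upwards [Ioo_mem_nhdsGT hr] with s hs
  exact massRatio_mono hT hT' hs.1 hs.2.le hΩ

theorem lelong_lt_top (hT : T.IsPositive) (hT' : T.IsPlurisubharmonic) {a : Cn n}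
    (ha : a ∈ Ω) : T.lelong a < ⊤ := by
  obtain ⟨R, hR, hΩ⟩ := Metric.isOpen_iff.1 Ω.isOpen a ha
  refine (lelong_le_massRatio hT hT' (half_pos hR)
    ((Metric.ball_subset_ball (half_le_self hR.le)).trans hΩ)).trans_lt ?_
  refine ENNReal.div_lt_top (traceMass_ball_lt_top hT hR (half_lt_self hR) hΩ).ne ?_
  rw [Ne, ENNReal.ofReal_eq_zero, not_le]
  positivity

/-- Upper semicontinuity: a ball around b of slightly smaller radius sits in a ball around a whose
ratio is already below d, and its ratio bounds the Lelong number at b. -/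
theorem eventually_lelong_lt (hT : T.IsPositive) (hT' : T.IsPlurisubharmonic) {a : Cn n}
    (ha : a ∈ Ω) {d : ℝ≥0∞} (hd : T.lelong a < d) : ∀ᶠ b in 𝓝 a, T.lelong b < d := by
  obtain ⟨R, hR, hΩ⟩ := Metric.isOpen_iff.1 Ω.isOpen a ha
  obtain ⟨r, hrd, hr⟩ := (((tendsto_massRatio hT hT' ha).eventually_lt_const hd).and
    (Ioo_mem_nhdsGT hR)).exists
  -- Keeping the mass of the r-ball but shrinking the radius in the denominator to s < r costs
  -- arbitrarily little.
  have hc : Tendsto (fun s : ℝ => T.traceMass (Metric.ball a r)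
      / ENNReal.ofReal (2 ^ p * Real.pi ^ p * s ^ (2 * p))) (𝓝[<] r) (𝓝 (T.massRatio a r)) := by
    refine ENNReal.Tendsto.const_div (ENNReal.tendsto_ofReal ?_) (Or.inl ENNReal.ofReal_ne_top)
    refine Tendsto.mono_left ?_ nhdsWithin_le_nhds
    exact (continuous_const.mul (continuous_pow _)).tendsto r
  obtain ⟨s, hsd, hs⟩ := ((hc.eventually_lt_const hrd).and (Ioo_mem_nhdsLT hr.1)).exists
  filter_upwards [Metric.ball_mem_nhds a (sub_pos.2 hs.2)] with b hb
  have hsub : Metric.ball b s ⊆ Metric.ball a r :=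
    Metric.ball_subset_ball' (by rw [Metric.mem_ball] at hb; linarith)
  refine (lelong_le_massRatio hT hT' hs.1
    ((hsub.trans (Metric.ball_subset_ball hr.2.le)).trans hΩ)).trans_lt (lt_of_le_of_lt ?_ hsd)
  unfold massRatio
  gcongr
  exact T.traceMass_mono hsub

/-! ### Packing, covering and Hausdorff measure -/

/-- Where one of two admissible functions with disjoint supports is nonzero the other vanishes, so
their sum is again bounded by 1 and admissible for the union. -/
theorem IsPositive.traceMass_add_le (hT : T.IsPositive) {A B : Set (Cn n)} (h : Disjoint A B) :
    T.traceMass A + T.traceMass B ≤ T.traceMass (A ∪ B) := by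
  unfold traceMass
  simp only [iSup_and']
  have h0 : (∀ x, 0 ≤ (0 : 𝓓(Ω, ℝ)) x ∧ (0 : 𝓓(Ω, ℝ)) x ≤ 1) := fun x =>
    ⟨le_refl (0 : ℝ), zero_le_one' ℝ⟩
  have ht : ∀ A : Set (Cn n), tsupport (0 : 𝓓(Ω, ℝ)) ⊆ A := fun A => by simp
  refine ENNReal.biSup_add_biSup_le' ⟨0, h0, ht A⟩ ⟨0, h0, ht B⟩ fun f hf g hg => ?_
  refine (le_of_eq ?_).trans (le_iSup₂_of_le (f + g) ⟨fun x => ?_, ?_⟩ le_rfl)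
  · have h1 := hT.traceIntegral_nonneg fun x => (hf.1 x).1
    have h2 := hT.traceIntegral_nonneg fun x => (hg.1 x).1
    exact (ENNReal.ofReal_add h1 h2).symm.trans
      (congrArg ENNReal.ofReal (T.traceIntegral_add f g).symm)
  · change 0 ≤ f x + g x ∧ f x + g x ≤ 1
    have hfx := hf.1 x
    have hgx := hg.1 x
    by_cases hx : x ∈ A
    · have : g x = 0 := image_eq_zero_of_notMem_tsupport
        fun hx' => disjoint_left.1 h hx (hg.2 hx')
      rw [this, add_zero]; exact hfx
    · have : f x = 0 := image_eq_zero_of_notMem_tsupport fun hx' => hx (hf.2 hx')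
      rw [this, zero_add]; exact hgx
  · exact (tsupport_add f g).trans (union_subset_union hf.2 hg.2)

theorem IsPositive.sum_traceMass_le (hT : T.IsPositive) {ι : Type*} (s : Finset ι)
    {B : ι → Set (Cn n)} (h : (s : Set ι).PairwiseDisjoint B) :
    ∑ i ∈ s, T.traceMass (B i) ≤ T.traceMass (⋃ i ∈ s, B i) := by
  classical
  induction s using Finset.induction_on with
  | empty => simp
  | insert i s hi ih =>
    rw [Finset.sum_insert hi, Finset.set_biUnion_insert]
    have hs : (s : Set ι).PairwiseDisjoint B := h.subset (by simp)
    have hd : Disjoint (B i) (⋃ j ∈ s, B j) := by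
      rw [disjoint_iUnion₂_right]
      exact fun j hj => h (by simp) (by simp [hj]) (by rintro rfl; exact hi hj)
    exact (add_le_add le_rfl (ih hs)).trans (hT.traceMass_add_le hd)

/-- The mass of a ball of radius `r` around a point of Lelong number `1`. -/
def unitMass (p : ℕ) (r : ℝ) : ℝ := 2 ^ p * Real.pi ^ p * r ^ (2 * p)

theorem unitMass_pos (p : ℕ) {r : ℝ} (hr : 0 < r) : 0 < unitMass p r := by
  unfold unitMass; positivity

/-- By monotonicity each ball of radius ε about a point of C carries mass at least δ 2^p π^p ε^{2p}.
These balls are disjoint and lie in the ball of radius 2R. -/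
theorem card_mul_unitMass_le (hT : T.IsPositive) (hT' : T.IsPlurisubharmonic) {y : Cn n}
    {R ε δ : ℝ} (hΩ : Metric.ball y (2 * R) ⊆ Ω) (hε : 0 < ε) (hεR : ε ≤ R)
    (C : Finset (Cn n)) (hC : ∀ b ∈ C, b ∈ Metric.ball y R ∧ ENNReal.ofReal δ ≤ T.lelong b)
    (hsep : (C : Set (Cn n)).Pairwise fun b c => 2 * ε ≤ dist b c) :
    C.card * (ENNReal.ofReal δ * ENNReal.ofReal (unitMass p ε))
      ≤ T.traceMass (Metric.ball y (2 * R)) := by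
  have hsub : ∀ b ∈ C, Metric.ball b ε ⊆ Metric.ball y (2 * R) := fun b hb =>
    Metric.ball_subset_ball' (by have := Metric.mem_ball.1 (hC b hb).1; linarith)
  calc (C.card : ℝ≥0∞) * (ENNReal.ofReal δ * ENNReal.ofReal (unitMass p ε))
      = ∑ _b ∈ C, ENNReal.ofReal δ * ENNReal.ofReal (unitMass p ε) := by simp
    _ ≤ ∑ b ∈ C, T.traceMass (Metric.ball b ε) := by
        refine Finset.sum_le_sum fun b hb => ?_
        have h1 := (hC b hb).2.trans (lelong_le_massRatio hT hT' hε ((hsub b hb).trans hΩ))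
        refine (ENNReal.le_div_iff_mul_le (Or.inl ?_) (Or.inl ENNReal.ofReal_ne_top)).1 h1
        rw [Ne, ENNReal.ofReal_eq_zero, not_le]
        exact unitMass_pos p hε
    _ ≤ T.traceMass (⋃ b ∈ C, Metric.ball b ε) := by
        refine hT.sum_traceMass_le C fun b hb c hc hbc => ?_
        exact Metric.ball_disjoint_ball (by have := hsep hb hc hbc; linarith)
    _ ≤ _ := T.traceMass_mono (iUnion₂_subset hsub)

/-- Finite covers of the part of a level set in a ball by balls of radius `2 ε`. -/
theorem exists_finset_cover (hT : T.IsPositive) (hT' : T.IsPlurisubharmonic) {y : Cn n}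
    {R ε δ : ℝ} (hΩ : Metric.ball y (2 * R) ⊆ Ω) (hε : 0 < ε) (hεR : ε ≤ R) (hδ : 0 < δ)
    (hM : T.traceMass (Metric.ball y (2 * R)) ≠ ⊤) :
    ∃ C : Finset (Cn n), C.card * (ENNReal.ofReal δ * ENNReal.ofReal (unitMass p ε))
        ≤ T.traceMass (Metric.ball y (2 * R)) ∧
      Metric.ball y R ∩ {b | ENNReal.ofReal δ ≤ T.lelong b} ⊆
        ⋃ b : C, Metric.closedBall (b : Cn n) (2 * ε) := by
  set A : Set (Cn n) := Metric.ball y R ∩ {b | ENNReal.ofReal δ ≤ T.lelong b} with hA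
  set ε' : ℝ≥0 := ⟨2 * ε, by positivity⟩ with hε'
  set m : ℝ≥0∞ := ENNReal.ofReal δ * ENNReal.ofReal (unitMass p ε) with hm
  have hm0 : m ≠ 0 := by
    have := unitMass_pos p hε
    simp [hm, hδ, this]
  have hbound : ∀ C : Finset (Cn n), (C : Set (Cn n)) ⊆ A → Metric.IsSeparated ε' (C : Set (Cn n)) →
      C.card * m ≤ T.traceMass (Metric.ball y (2 * R)) := fun C hCA hC =>
    card_mul_unitMass_le hT hT' hΩ hε hεR C (fun b hb => hCA hb) fun b hb c hc hbc => by
      have h : (ε' : ℝ≥0∞) < edist b c := hC hb hc hbc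
      rw [edist_nndist, ENNReal.coe_lt_coe] at h
      exact le_of_lt h
  -- A separated set with more than N > M/m points would contain one with exactly N points, M being
  -- the total mass, contradicting the packing bound.
  have hfin : Metric.packingNumber ε' A ≠ ⊤ := by
    obtain ⟨N, hN⟩ := ENNReal.exists_nat_gt (ENNReal.div_ne_top hM hm0)
    refine ne_top_of_le_ne_top (ENat.natCast_ne_top N) (iSup_le fun C => iSup_le fun hCA =>
      iSup_le fun hC => ?_)
    by_contra! hlt
    obtain ⟨D, hDC, hD⟩ := Set.exists_subset_encard_eq hlt.le
    have hDf : D.Finite := Set.finite_of_encard_eq_coe hD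
    have h1 := hbound hDf.toFinset (by simpa using hDC.trans hCA) (by
      rw [hDf.coe_toFinset]; exact hC.subset hDC)
    have h2 : hDf.toFinset.card = N := by
      rw [hDf.encard_eq_coe_toFinset_card] at hD
      exact_mod_cast hD
    rw [h2] at h1
    have h3 := (ENNReal.le_div_iff_mul_le (Or.inl hm0)
      (Or.inr hM)).2 h1
    exact absurd hN h3.not_gt
  have hcfin : (Metric.maximalSeparatedSet ε' A).Finite := by
    rw [← Set.encard_ne_top_iff, Metric.encard_maximalSeparatedSet hfin]
    exact hfin
  refine ⟨hcfin.toFinset, hbound _ (by simpa using Metric.maximalSeparatedSet_subset)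
    (by simpa using Metric.isSeparated_maximalSeparatedSet), fun x hx => ?_⟩
  -- A maximal 2ε-separated set is a 2ε-net.
  obtain ⟨b, hb, hxb⟩ := Metric.isCover_maximalSeparatedSet hfin hx
  refine mem_iUnion.2 ⟨⟨b, by simpa using hb⟩, ?_⟩
  have hxb' : edist x b ≤ ε' := hxb
  rw [edist_nndist, ENNReal.coe_le_coe] at hxb'
  exact hxb'

theorem exists_nhds_hausdorffMeasure_lt_top (hT : T.IsPositive) (hT' : T.IsPlurisubharmonic)
    {y : Cn n} (hy : y ∈ Ω) {δ : ℝ} (hδ : 0 < δ) :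
    ∃ U ∈ 𝓝 y, μH[(2 * p : ℝ)] (U ∩ {b | ENNReal.ofReal δ ≤ T.lelong b}) < ⊤ := by
  obtain ⟨R', hR', hΩ'⟩ := Metric.isOpen_iff.1 Ω.isOpen y hy
  obtain ⟨R, hR, hRR'⟩ : ∃ R, 0 < R ∧ 2 * R < R' := ⟨R' / 4, by positivity, by linarith⟩
  have hΩ : Metric.ball y (2 * R) ⊆ Ω := (Metric.ball_subset_ball hRR'.le).trans hΩ'
  have hM := (traceMass_ball_lt_top hT hR' hRR' hΩ').ne
  refine ⟨Metric.ball y R, Metric.ball_mem_nhds y hR, ?_⟩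
  set M := T.traceMass (Metric.ball y (2 * R)) with hMdef
  set ε : ℕ → ℝ := fun k => R / (k + 1) with hεdef
  have hε : ∀ k, 0 < ε k := fun k => by positivity
  have hεR : ∀ k, ε k ≤ R := fun k => div_le_self hR.le (by simp)
  have hεt : Tendsto ε atTop (𝓝 0) := by
    simpa [hεdef, div_eq_mul_inv] using (tendsto_one_div_add_atTop_nhds_zero_nat (𝕜 := ℝ)).const_mul R
  choose C hC hcov using fun k => exists_finset_cover hT hT' hΩ (hε k) (hεR k) hδ hM
  -- Chosen so that (4ε)^{2p} = K δ 2^p π^p ε^{2p}, where 4ε bounds the diameter of a covering ball.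
  -- The powers of ε then cancel against the bound on the number of balls.
  set K : ℝ := 4 ^ (2 * p) / (δ * (2 ^ p * Real.pi ^ p)) with hK
  have hbound : ∀ k, ∑ b : C k, Metric.ediam (Metric.closedBall (b : Cn n) (2 * ε k)) ^ (2 * p : ℝ)
      ≤ ENNReal.ofReal K * M := by
    intro k
    have hd : ∀ b : C k, Metric.ediam (Metric.closedBall (b : Cn n) (2 * ε k)) ^ (2 * p : ℝ)
        ≤ ENNReal.ofReal K * (ENNReal.ofReal δ * ENNReal.ofReal (unitMass p (ε k))) := by
      intro b
      have h1 : Metric.ediam (Metric.closedBall (b : Cn n) (2 * ε k))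
          ≤ ENNReal.ofReal (4 * ε k) := by
        refine Metric.ediam_le_of_forall_dist_le fun u hu v hv => ?_
        have := dist_triangle_right u v b
        rw [Metric.mem_closedBall] at hu hv
        linarith
      have h2 : ((2 : ℝ) * p) = ((2 * p : ℕ) : ℝ) := by push_cast; rfl
      calc _ ≤ ENNReal.ofReal (4 * ε k) ^ (2 * p : ℝ) := by gcongr
        _ = ENNReal.ofReal ((4 * ε k) ^ (2 * p)) := by
            rw [h2, ENNReal.rpow_natCast, ENNReal.ofReal_pow (by have := hε k; positivity)]
        _ = _ := by
            rw [← ENNReal.ofReal_mul hδ.le, ← ENNReal.ofReal_mul (by positivity)]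
            congr 1
            rw [hK, unitMass, mul_pow]
            field_simp
    calc _ ≤ ∑ _b : C k, ENNReal.ofReal K * (ENNReal.ofReal δ * ENNReal.ofReal (unitMass p (ε k))) :=
          Finset.sum_le_sum fun b _ => hd b
      _ = ENNReal.ofReal K * ((C k).card *
            (ENNReal.ofReal δ * ENNReal.ofReal (unitMass p (ε k)))) := by
          simp [mul_left_comm]
      _ ≤ _ := by gcongr; exact hC k
  have hr : Tendsto (fun k => ENNReal.ofReal (4 * ε k)) atTop (𝓝 0) := by
    have := ENNReal.tendsto_ofReal (hεt.const_mul 4)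
    simpa using this
  have hle := Measure.hausdorffMeasure_le_liminf_sum (2 * p : ℝ)
    (Metric.ball y R ∩ {b | ENNReal.ofReal δ ≤ T.lelong b})
    (fun k => ENNReal.ofReal (4 * ε k)) hr
    (fun k (b : C k) => Metric.closedBall (b : Cn n) (2 * ε k))
    (Eventually.of_forall fun k b => by
      refine Metric.ediam_le_of_forall_dist_le fun u hu v hv => ?_
      have := dist_triangle_right u v b
      rw [Metric.mem_closedBall] at hu hv
      linarith)
    (Eventually.of_forall hcov)
  refine hle.trans_lt (lt_of_le_of_lt (b := ENNReal.ofReal K * M) ?_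
    (ENNReal.mul_lt_top ENNReal.ofReal_lt_top hM.lt_top))
  exact (liminf_le_liminf (Eventually.of_forall hbound)).trans_eq (liminf_const _)

end LocalCurrent

/-! ### Passage from charts to the manifold -/

namespace Current

variable {n p : ℕ} {V : Type*} [TopologicalSpace V] [ChartedSpace (Cn n) V]
  {T : Current n V (2 * p)}

/-- With the Lelong number defined as an infimum over charts, this inequality places the level set
of `T`, read in any chart, inside the level set of the local current. Independence of coordinates is
therefore not needed. -/
theorem lelong_le_inChart (T : Current n V (2 * p)) (φ : HolChart n V) {a : V}
    (ha : a ∈ φ.1.source) : T.lelong a ≤ (T.inChart φ).lelong (φ.1 a) :=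
  iInf_le_of_le φ (iInf_le _ ha)

theorem isClosed_levelSet (hpos : T.IsPositive) (hpsh : T.IsPlurisubharmonic) (δ : ℝ) :
    IsClosed (T.levelSet δ) := by
  refine isClosed_of_closure_subset fun a ha => ?_
  change ENNReal.ofReal δ ≤ T.lelong a
  unfold Current.lelong
  refine le_iInf fun φ => le_iInf fun hφ => ?_
  -- If the bound failed in one chart at a, it would fail there near a, and so at nearby points of
  -- the level set.
  by_contra! hlt
  have hev := LocalCurrent.eventually_lelong_lt (hpos φ) (hpsh φ) (φ.1.map_source hφ) hlt
  have hev' := ((φ.1.continuousAt hφ).eventually hev).and (φ.1.open_source.mem_nhds hφ)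
  obtain ⟨b, hb, hbδ⟩ := mem_closure_iff_nhds.1 ha _ hev'
  exact absurd (hbδ.trans (T.lelong_le_inChart φ hb.2)) hb.1.not_ge

theorem locallyFiniteHausdorff_levelSet (hpos : T.IsPositive) (hpsh : T.IsPlurisubharmonic)
    {δ : ℝ} (hδ : 0 < δ) : LocallyFiniteHausdorff n (2 * p : ℝ) (T.levelSet δ) := by
  intro φ y hy
  obtain ⟨U, hU, hlt⟩ :=
    LocalCurrent.exists_nhds_hausdorffMeasure_lt_top (hpos φ) (hpsh φ) hy hδ
  refine ⟨U, hU, lt_of_le_of_lt (measure_mono (inter_subset_inter_right U ?_)) hlt⟩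
  rintro _ ⟨a, ⟨ha, haφ⟩, rfl⟩
  exact le_trans ha (T.lelong_le_inChart φ haφ)

end Current

theorem LocallyFiniteHausdorff.mono {n : ℕ} {V : Type*} [TopologicalSpace V]
    [ChartedSpace (Cn n) V] {d : ℝ} {S S' : Set V} (h : LocallyFiniteHausdorff n d S)
    (hS : S' ⊆ S) : LocallyFiniteHausdorff n d S' := fun φ y hy => by
  obtain ⟨U, hU, hlt⟩ := h φ y hy
  exact ⟨U, hU, lt_of_le_of_lt (measure_mono (by gcongr)) hlt⟩

end

end CurrentTheory

end

open CurrentTheory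

theorem proposition4 {n p : ℕ} {V : Type*} [TopologicalSpace V] [T2Space V]
    [ChartedSpace (Cn n) V] [IsManifold 𝓘(ℂ, Cn n) ω V]
    (T : Current n V (2 * p)) (hbidim : T.IsBidim) (hpos : T.IsPositive)
    (hpsh : T.IsPlurisubharmonic) :
    (∀ (φ : HolChart n V), ∀ a ∈ φ.1.source, ∃ l : ℝ≥0,
      Tendsto ((T.inChart φ).massRatio (φ.1 a)) (𝓝[>] (0 : ℝ)) (𝓝 (l : ℝ≥0∞))) ∧
    (∀ δ : ℝ, 0 < δ →
      IsClosed (T.levelSet δ) ∧ LocallyFiniteHausdorff n (2 * p : ℝ) (T.levelSet δ)) ∧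
    (∀ δ : ℝ, 0 < δ → T.support ⊆ closure (T.levelSet δ) →
      (∀ a ∈ T.support, ENNReal.ofReal δ ≤ T.lelong a) ∧
      LocallyFiniteHausdorff n (2 * p : ℝ) T.support) := by
  refine ⟨fun φ a ha => ?_, fun δ hδ => ⟨Current.isClosed_levelSet hpos hpsh δ,
    Current.locallyFiniteHausdorff_levelSet hpos hpsh hδ⟩, fun δ hδ hsupp => ?_⟩
  · have hmem := φ.1.map_source ha
    refine ⟨((T.inChart φ).lelong (φ.1 a)).toNNReal, ?_⟩
    rw [ENNReal.coe_toNNReal (LocalCurrent.lelong_lt_top (hpos φ) (hpsh φ) hmem).ne]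
    exact LocalCurrent.tendsto_massRatio (hpos φ) (hpsh φ) hmem
  · have hsub : T.support ⊆ T.levelSet δ :=
      hsupp.trans_eq (Current.isClosed_levelSet hpos hpsh δ).closure_eq
    exact ⟨fun a ha => hsub ha,
      (Current.locallyFiniteHausdorff_levelSet hpos hpsh hδ).mono hsub⟩
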